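/- Let $L^2=L^2([0,1])$ be the real Hilbert space with inner product $\langle\cdot,\cdot\rangle$, let $S\in\mathbb N$, and let $\{\psi_{lk}: l\in\mathcal L,\ k\in\mathcal Z_l\}$, with $\mathcal L\subset\mathbb Z$ and $\mathcal Z_l\subset\mathbb Z$, be an $S$-regular orthonormal basis of $L^2$ with characteristic sequence $(a_l)$: each $\psi_{lk}$ is $S$-times differentiable on $[0,1]$ with all derivatives in $L^2$, and either (a) $|\mathcal Z_l|=1$ and $a_l=\max(2,|l|)$ for all $l\in\mathcal L$, or (b) $\mathcal L\subset\{1,2,\dots\}$ and $|\mathcal Z_l|=a_l=2^l$ for all $l\in\mathcal L$. For $\delta>1/2$ let $H(\delta)$ be the Hilbert space of all $f$, identified with their coefficient arrays $(f_{lk})=(\langle\psi_{lk},f\rangle)$, such that $$\|f\|_{H(\delta)}^2=\sum_{l\in\mathcal L}a_l^{-1}(\log a_l)^{-2\delta}\sum_{k\in\mathcal Z_l}|f_{lk}|^2<\infty ;$$ it contains $L^2$. Let $\mathbb W$ be the random element of $H(\delta)$ whose coefficients are i.i.d. $N(0,1)$, let $\mathcal N$ be its law on $H(\delta)$, and for $f\in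 L^2$, $n\ge1$ let $P_f^n$ be the law on $H(\delta)$ of $\mathbb X^{(n)}=f+n^{-1/2}\mathbb W$ (the white noise model $dX^{(n)}(t)=f(t)\,dt+n^{-1/2}\,dW(t)$). Let $\varphi$ be a probability density on $\mathbb R$ and let $\sigma_l>0$ satisfy $\sum_{l,k}\sigma_l^2<\infty$. Let $\Pi=\bigotimes_{l,k}\pi_{lk}$ be the product prior on $L^2$, i.e. the law of $\sum_{l,k}\theta_{lk}\psi_{lk}$ where the $\theta_{lk}$ are independent with Lebesgue densities $\varphi_{lk}=\sigma_l^{-1}\varphi(\cdot/\sigma_l)$, and let $\Pi_n=\Pi(\cdot\mid\mathbb X^{(n)})$ be the posterior distribution when $f\sim\Pi$ and $\mathbb X^{(n)}\mid f\sim P_f^n$. Let $f_0\in L^2$ have coefficients $\theta_{0,lk}=\langle f_0,\psi_{lk}\rangle$, and suppose that (P1) for a finite constant $M>0$, $\ \sup_{l\in\mathcal L,k\in\mathcal Z_l}|\theta_{0,lk}|/\sigma_l\le M$; (P2) for some $\tau>M$ and $0<c_\varphi\le C_\varphi<\infty$: $\ \varphi\le C_\varphi$ on $\mathbb R$, $\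 \varphi\ge c_\varphi$ on $(-\tau,\tau)$, and $\int_{\mathbb R}x^2\varphi(x)\,dx<\infty$; and that for all $l\in\mathcal L$, $k\in\mathcal Z_l$ the density $\varphi$ is continuous in a neighbourhood of $\theta_{0,lk}/\sigma_l$ (equivalently, $\varphi_{lk}$ is continuous in a neighbourhood of $\theta_{0,lk}$). Then for every $\delta>1/2$ the weak Bernstein–von Mises phenomenon holds in $H(\delta)$: with $\tau_z(f)=\sqrt n\,(f-z)$ and $$\beta(\mu,\nu)=\sup\Big\{\Big|\int u\,d\mu-\int u\,d\nu\Big| : u:H(\delta)\to\mathbb R,\ \sup_{s}|u(s)|+\sup_{s\ne t}\frac{|u(s)-u(t)|}{\|s-t\|_{H(\delta)}}\le1\Big\}$$ the bounded Lipschitz metric, $\beta\big(\Pi_n\circ\tau_{\mathbb X^{(n)}}^{-1},\mathcal N\big)\to0$ in $P_{f_0}^n$-probability as $n\to\infty$, that is, $P_{f_0}^n\big(\beta(\Pi_n\circ\tau_{\mathbb X^{(n)}}^{-1},\mathcal N)>\varepsilon\big)\to0$ for every $\varepsilon>0$. -/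

import Mathlib

open MeasureTheory ProbabilityTheory Filter Topology Set

namespace WhiteNoise

noncomputable section

/-- The real Hilbert space `L²([0,1])`, with its Borel σ-algebra. -/
abbrev L2 : Type := Lp ℝ 2 (volume.restrict (Icc (0 : ℝ) 1))

instance : MeasurableSpace L2 := borel L2

instance : BorelSpace L2 := ⟨rfl⟩

instance : SecondCountableTopology L2 :=
  haveI : Fact ((2 : ENNReal) ≠ ⊤) := ⟨by norm_num⟩
  Lp.SecondCountableTopology

/-- An `S`-regular orthonormal basis `{ψ_{lk} : l ∈ 𝓛, k ∈ Z l}` of `L²([0,1])` with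
characteristic sequence `a`. -/
structure RegularBasis (S : ℕ) where
  𝓛 : Set ℤ
  Z : ℤ → Finset ℤ
  a : ℤ → ℝ
  ψ : HilbertBasis (Σ l : 𝓛, Z l) ℝ L2
  /-- Each `ψ_{lk}` is (represented by) an `S`-times differentiable function on `[0,1]` with all
  derivatives of order at most `S` in `L²`. -/
  regular : ∀ i, ∃ g : ℝ → ℝ,
    (∀ᵐ x ∂(volume.restrict (Icc (0 : ℝ) 1)), (ψ i : ℝ → ℝ) x = g x) ∧
    (∀ j < S, DifferentiableOn ℝ (iteratedDerivWithin j g (Icc 0 1)) (Icc 0 1)) ∧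
    (∀ j ≤ S, MemLp (iteratedDerivWithin j g (Icc 0 1)) 2 (volume.restrict (Icc (0 : ℝ) 1)))
  /-- Either one basis function per level and `a_l = max(2,|l|)`, or `2^l` basis functions at each
  level `l ∈ 𝓛 ⊂ {1,2,…}` and `a_l = 2^l`. -/
  type : (∀ l ∈ 𝓛, (Z l).card = 1 ∧ a l = max 2 (|l| : ℝ)) ∨
    (∀ l ∈ 𝓛, 1 ≤ l ∧ (Z l).card = 2 ^ l.toNat ∧ a l = (2 : ℝ) ^ l)

namespace RegularBasis

variable {S : ℕ} (B : RegularBasis S)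

/-- The set of pairs `(l,k)` with `l ∈ 𝓛` and `k ∈ Z l`. -/
abbrev Index : Type := Σ l : B.𝓛, B.Z l

/-- The coefficients `⟨f, ψ_{lk}⟩`. -/
def coeff (f : L2) (i : B.Index) : ℝ := inner ℝ (B.ψ i) f

theorem two_le_a (i : B.Index) : 2 ≤ B.a i.1 := by
  rcases B.type with h | h
  · rw [(h i.1 i.1.2).2]; exact le_max_left _ _
  · obtain ⟨h1, -, h3⟩ := h i.1 i.1.2
    rw [h3]
    calc (2 : ℝ) = 2 ^ (1 : ℤ) := by norm_num
      _ ≤ 2 ^ (i.1 : ℤ) := zpow_le_zpow_right₀ (by norm_num) h1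

/-- The weight `a_l^{2s} (log a_l)^{-2δ}`. -/
def weight (s δ : ℝ) (i : B.Index) : ℝ := B.a i.1 ^ (2 * s) / Real.log (B.a i.1) ^ (2 * δ)

theorem weight_pos (s δ : ℝ) (i : B.Index) : 0 < B.weight s δ i := by
  have h := B.two_le_a i
  have h1 : 0 < Real.log (B.a i.1) := Real.log_pos (by linarith)
  unfold weight
  positivity

/-- The coefficient arrays `c = (c_{lk})` with `∑ a_l^{2s} (log a_l)^{-2δ} |c_{lk}|² < ∞`. -/
def logSobolevSubmodule (s δ : ℝ) : Submodule ℝ (B.Index → ℝ) where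
  carrier := {c | Summable fun i => B.weight s δ i * c i ^ 2}
  zero_mem' := by simp [summable_zero]
  add_mem' := by
    intro c d hc hd
    refine Summable.of_nonneg_of_le
      (fun i => mul_nonneg (B.weight_pos s δ i).le (sq_nonneg _)) (fun i => ?_)
      ((hc.add hd).mul_left 2)
    have := (B.weight_pos s δ i).le
    simp only [Pi.add_apply]
    nlinarith [mul_nonneg this (sq_nonneg (c i - d i))]
  smul_mem' := by
    intro t c hc
    refine (hc.mul_left (t ^ 2)).congr (fun i => ?_)
    simp only [Pi.smul_apply, smul_eq_mul]
    ring

/-- The logarithmic Sobolev space `H^{s,δ}_2`; its elements `f` (functions, or linear forms when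
`s < 0`) are identified with their coefficients `(⟨ψ_{lk}, f⟩)_{lk}`. -/
def LogSobolev (s δ : ℝ) : Type := B.logSobolevSubmodule s δ

instance (s δ : ℝ) : AddCommGroup (B.LogSobolev s δ) :=
  inferInstanceAs (AddCommGroup (B.logSobolevSubmodule s δ))

instance (s δ : ℝ) : Module ℝ (B.LogSobolev s δ) :=
  inferInstanceAs (Module ℝ (B.logSobolevSubmodule s δ))

variable {B} in
/-- The coefficients of an element of `H^{s,δ}_2`. -/
def LogSobolev.val {s δ : ℝ} (f : B.LogSobolev s δ) : B.Index → ℝ := Subtype.val f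

theorem memℓp_two_iff {ι : Type*} (x : ι → ℝ) : Memℓp x 2 ↔ Summable fun i => x i ^ 2 := by
  rw [memℓp_gen_iff (by norm_num)]
  simp

/-- The array `c` as an element of `ℓ²`, and `0` if `c ∉ ℓ²`. -/
def seqToEll2 {ι : Type*} (c : ι → ℝ) : lp (fun _ : ι => ℝ) 2 :=
  open scoped Classical in if h : Memℓp c 2 then ⟨c, h⟩ else 0

/-- Multiplication of the coefficients by the square roots of the weights. -/
def toEll2 (s δ : ℝ) : B.LogSobolev s δ →ₗ[ℝ] lp (fun _ : B.Index => ℝ) 2 where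
  toFun f := ⟨fun i => √(B.weight s δ i) * f.val i, by
    refine (memℓp_two_iff _).2 (Summable.congr f.2 fun i => ?_)
    rw [mul_pow, Real.sq_sqrt (B.weight_pos s δ i).le]
    rfl⟩
  map_add' f g := by
    ext i
    exact mul_add _ _ _
  map_smul' t f := by
    ext i
    exact mul_left_comm _ _ _

theorem toEll2_injective (s δ : ℝ) : Function.Injective (B.toEll2 s δ) := by
  intro f g h
  refine Subtype.ext (funext fun i => ?_)
  have h' : √(B.weight s δ i) * f.val i = √(B.weight s δ i) * g.val i :=
    congrFun (congrArg Subtype.val h) i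
  exact mul_left_cancel₀ (Real.sqrt_pos.2 (B.weight_pos s δ i)).ne' h'

instance (s δ : ℝ) : NormedAddCommGroup (B.LogSobolev s δ) :=
  NormedAddCommGroup.induced _ _ (B.toEll2 s δ) (B.toEll2_injective s δ)

instance (s δ : ℝ) : NormedSpace ℝ (B.LogSobolev s δ) :=
  NormedSpace.induced ℝ _ _ (B.toEll2 s δ)

/-- The norm is `‖f‖² = ∑ a_l^{2s} (log a_l)^{-2δ} |⟨ψ_{lk}, f⟩|²`. -/
theorem norm_sq_eq {s δ : ℝ} (f : B.LogSobolev s δ) :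
    ‖f‖ ^ 2 = ∑' i, B.weight s δ i * f.val i ^ 2 := by
  have h : ‖f‖ = ‖B.toEll2 s δ f‖ := rfl
  have h2 := lp.norm_rpow_eq_tsum (p := 2) (by norm_num) (B.toEll2 s δ f)
  simp only [ENNReal.toReal_ofNat, Real.rpow_two] at h2
  rw [h, h2]
  refine tsum_congr fun i => ?_
  have : (B.toEll2 s δ f) i = √(B.weight s δ i) * f.val i := rfl
  rw [this, Real.norm_eq_abs, sq_abs, mul_pow, Real.sq_sqrt (B.weight_pos s δ i).le]

instance (s δ : ℝ) : MeasurableSpace (B.LogSobolev s δ) := borel _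

instance (s δ : ℝ) : BorelSpace (B.LogSobolev s δ) := ⟨rfl⟩

theorem isometry_toEll2 (s δ : ℝ) : Isometry (B.toEll2 s δ) :=
  AddMonoidHomClass.isometry_of_norm (B.toEll2 s δ) fun _ => rfl

instance secondCountable_ell2 : SecondCountableTopology (lp (fun _ : B.Index => ℝ) 2) :=
  B.ψ.repr.symm.toHomeomorph.isEmbedding.secondCountableTopology

instance (s δ : ℝ) : SecondCountableTopology (B.LogSobolev s δ) :=
  (B.isometry_toEll2 s δ).isEmbedding.secondCountableTopology

instance : MeasurableSpace (lp (fun _ : B.Index => ℝ) 2) := borel _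

instance : BorelSpace (lp (fun _ : B.Index => ℝ) 2) := ⟨rfl⟩

theorem measurableSet_memℓp {ι : Type*} [Countable ι] :
    MeasurableSet {c : ι → ℝ | Memℓp c 2} := by
  have h : {c : ι → ℝ | Memℓp c 2} = {c | ∑' i, ENNReal.ofReal (c i ^ 2) ≠ ⊤} := by
    ext c
    rw [mem_ofPred_eq, mem_ofPred_eq, memℓp_two_iff]
    refine ⟨fun hc => hc.tsum_ofReal_ne_top, fun hc => ?_⟩
    refine (ENNReal.summable_toReal hc).congr fun i => ENNReal.toReal_ofReal (sq_nonneg _)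
  rw [h]
  have hm : Measurable fun c : ι → ℝ => ∑' i, ENNReal.ofReal (c i ^ 2) := by fun_prop
  exact hm (measurableSet_singleton ⊤).compl

theorem measurable_seqToEll2 : Measurable (seqToEll2 : (B.Index → ℝ) → _) := by
  classical
  let F : Finset B.Index → (B.Index → ℝ) → lp (fun _ : B.Index => ℝ) 2 := fun s c =>
    if Memℓp c 2 then ∑ i ∈ s, lp.single 2 i (c i) else 0
  refine measurable_of_tendsto_metrizable' (f := F) atTop (fun s => ?_) ?_
  · refine Measurable.ite measurableSet_memℓp (Continuous.measurable ?_) measurable_const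
    refine continuous_finsetSum _ fun i _ => ?_
    exact (lp.isometry_single i).continuous.comp (continuous_apply i)
  · refine tendsto_pi_nhds.2 fun c => ?_
    by_cases hc : Memℓp c 2
    · simp only [F, if_pos hc, seqToEll2, dif_pos hc]
      exact lp.hasSum_single (by norm_num) (⟨c, hc⟩ : lp (fun _ : B.Index => ℝ) 2)
    · simp only [F, if_neg hc, seqToEll2, dif_neg hc]
      exact tendsto_const_nhds

/-- The element of `H^{s,δ}_2` with the coefficients `c`, and `0` if there is none. -/
def ofSeq (s δ : ℝ) (c : B.Index → ℝ) : B.LogSobolev s δ :=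
  open scoped Classical in
  if h : Summable (fun i => B.weight s δ i * c i ^ 2) then ⟨c, h⟩ else 0

theorem ofSeq_val {s δ : ℝ} {c : B.Index → ℝ}
    (h : Summable fun i => B.weight s δ i * c i ^ 2) : (B.ofSeq s δ c).val = c := by
  have : B.ofSeq s δ c = ⟨c, h⟩ := dif_pos h
  rw [this]
  rfl

theorem toEll2_ofSeq (s δ : ℝ) (c : B.Index → ℝ) :
    B.toEll2 s δ (B.ofSeq s δ c) = seqToEll2 fun i => √(B.weight s δ i) * c i := by
  have hiff : Memℓp (fun i => √(B.weight s δ i) * c i) 2 ↔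
      Summable fun i => B.weight s δ i * c i ^ 2 := by
    rw [memℓp_two_iff]
    refine summable_congr fun i => ?_
    rw [mul_pow, Real.sq_sqrt (B.weight_pos s δ i).le]
  by_cases h : Summable fun i => B.weight s δ i * c i ^ 2
  · rw [seqToEll2, dif_pos (hiff.2 h)]
    refine Subtype.ext (funext fun i => ?_)
    exact congrArg (fun d : B.Index → ℝ => √(B.weight s δ i) * d i) (B.ofSeq_val h)
  · rw [seqToEll2, dif_neg (mt hiff.1 h)]
    have : B.ofSeq s δ c = 0 := dif_neg h
    rw [this, map_zero]

theorem measurable_ofSeq (s δ : ℝ) : Measurable (B.ofSeq s δ) := by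
  have h : Measurable fun c => B.toEll2 s δ (B.ofSeq s δ c) := by
    simp only [toEll2_ofSeq]
    exact B.measurable_seqToEll2.comp (by fun_prop)
  have hb : borel (B.LogSobolev s δ) = MeasurableSpace.comap (B.toEll2 s δ) (borel _) := by
    rw [← borel_comap, ← (B.isometry_toEll2 s δ).isEmbedding.eq_induced]
  rw [BorelSpace.measurable_eq (α := B.LogSobolev s δ), hb]
  exact measurable_comap_iff.2 h

/-- The space `H(δ) = H^{-1/2,δ}_2`. -/
abbrev H (δ : ℝ) : Type := B.LogSobolev (-1 / 2) δ

/-- The inclusion of `L²` in `H(δ)`, for `δ ≥ 0`. -/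
def incl (δ : ℝ) (f : L2) : B.H δ := B.ofSeq (-1 / 2) δ (B.coeff f)

theorem summable_coeff {δ : ℝ} (hδ : 0 ≤ δ) (f : L2) :
    Summable fun i => B.weight (-1 / 2) δ i * B.coeff f i ^ 2 := by
  have h1 : Summable fun i => B.coeff f i ^ 2 := by
    refine ((memℓp_two_iff _).1 (B.ψ.repr f).2).congr fun i => ?_
    rw [coeff, B.ψ.repr_apply_apply]
  refine Summable.of_nonneg_of_le
    (fun i => mul_nonneg (B.weight_pos _ δ i).le (sq_nonneg _)) (fun i => ?_)
    (h1.mul_left (1 / Real.log 2 ^ (2 * δ)))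
  refine mul_le_mul_of_nonneg_right ?_ (sq_nonneg _)
  have h2 := B.two_le_a i
  have h3 : 0 < Real.log 2 := Real.log_pos (by norm_num)
  have h4 : Real.log 2 ≤ Real.log (B.a i.1) := Real.log_le_log (by norm_num) h2
  refine div_le_div₀ zero_le_one ?_ (by positivity)
    (Real.rpow_le_rpow h3.le h4 (by linarith))
  exact Real.rpow_le_one_of_one_le_of_nonpos (by linarith) (by norm_num)

theorem incl_val {δ : ℝ} (hδ : 0 ≤ δ) (f : L2) : (B.incl δ f).val = B.coeff f :=
  B.ofSeq_val (B.summable_coeff hδ f)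

theorem measurable_incl (δ : ℝ) : Measurable (B.incl δ) := by
  refine (B.measurable_ofSeq _ _).comp (measurable_pi_lambda _ fun i => ?_)
  exact (innerSL ℝ (B.ψ i)).continuous.measurable

/-- The function `∑ c_{lk} ψ_{lk} ∈ L²`, and `0` if `c ∉ ℓ²`. -/
def synthesis (c : B.Index → ℝ) : L2 := B.ψ.repr.symm (seqToEll2 c)

theorem measurable_synthesis : Measurable B.synthesis :=
  B.ψ.repr.symm.continuous.measurable.comp B.measurable_seqToEll2

/-- The canonical Gaussian measure `𝒩` on `H(δ)`: the law of the white noise `𝕎`, whose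
coefficients `𝕎(ψ_{lk})` are independent standard normal. -/
def gaussian (δ : ℝ) : Measure (B.H δ) :=
  (Measure.infinitePi fun _ : B.Index => gaussianReal 0 1).map (B.ofSeq (-1 / 2) δ)

instance (δ : ℝ) : IsProbabilityMeasure (B.gaussian δ) :=
  Measure.isProbabilityMeasure_map (B.measurable_ofSeq _ _).aemeasurable

/-- The white noise experiment: `P_f^n` is the law on `H(δ)` of `𝕏^{(n)} = f + 𝕎 / √n`. -/
def experiment (δ : ℝ) (n : ℕ) : Kernel L2 (B.H δ) where
  toFun f := (B.gaussian δ).map fun w => B.incl δ f + (√(n : ℝ))⁻¹ • w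
  measurable' := by
    have h : Measurable fun p : L2 × B.H δ => B.incl δ p.1 + (√(n : ℝ))⁻¹ • p.2 :=
      ((B.measurable_incl δ).comp measurable_fst).add (Measurable.const_smul measurable_snd (√(n : ℝ))⁻¹)
    refine Measure.measurable_of_measurable_coe _ fun t ht => ?_
    convert measurable_measure_prodMk_left (ν := B.gaussian δ) (h ht) using 2 with f
    rw [Measure.map_apply (by fun_prop) ht]
    rfl

instance (δ : ℝ) (n : ℕ) : IsMarkovKernel (B.experiment δ n) :=
  ⟨fun f => Measure.isProbabilityMeasure_map
    (by fun_prop : Measurable fun w => B.incl δ f + (√(n : ℝ))⁻¹ • w).aemeasurable⟩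

/-- The posterior distribution `Π(· | 𝕏^{(n)} = x)` on `L²`, when `f ∼ Π` and `𝕏^{(n)} | f ∼ P_f^n`. -/
def posterior (δ : ℝ) (ν₀ : Measure L2) [IsProbabilityMeasure ν₀] (n : ℕ) : Kernel (B.H δ) L2 :=
  ProbabilityTheory.posterior (B.experiment δ n) ν₀

/-- The law `Π_n ∘ τ_x⁻¹` on `H(δ)`, where `τ_x(f) = √n (f - x)`. -/
def rescaledPosterior (δ : ℝ) (ν₀ : Measure L2) [IsProbabilityMeasure ν₀] (n : ℕ) (x : B.H δ) :
    Measure (B.H δ) :=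
  ((B.posterior δ ν₀ n x).map (B.incl δ)).map fun h => √(n : ℝ) • (h - x)

end RegularBasis

/-- The class `BL(1)` of functions `u` with `sup |u| + Lip(u) ≤ 1`. -/
def BL1 (T : Type*) [PseudoMetricSpace T] : Set (T → ℝ) :=
  {u | ∃ (b : ℝ) (K : NNReal), (∀ t, |u t| ≤ b) ∧ LipschitzWith K u ∧ b + K ≤ 1}

/-- The bounded Lipschitz metric `β(μ,ν) = sup_{u ∈ BL(1)} |∫ u dμ - ∫ u dν|`. -/
def boundedLipschitzDist {T : Type*} [PseudoMetricSpace T] [MeasurableSpace T]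
    (μ ν : Measure T) : ℝ :=
  sSup ((fun u : T → ℝ => |∫ t, u t ∂μ - ∫ t, u t ∂ν|) '' BL1 T)

/-- The weak Bernstein–von Mises phenomenon in `H(δ)` for the prior `ν₀` at `f₀`:
`β(Π_n ∘ τ_{𝕏^{(n)}}⁻¹, 𝒩) → 0` in `P_{f₀}^n`-probability. -/
def WeakBernsteinVonMises {S : ℕ} (B : RegularBasis S) (δ : ℝ) (ν₀ : Measure L2)
    [IsProbabilityMeasure ν₀] (f₀ : L2) : Prop :=
  ∀ ε : ℝ, 0 < ε → Tendsto (fun n : ℕ => B.experiment δ n f₀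
    {x | ε < boundedLipschitzDist (B.rescaledPosterior δ ν₀ n x) (B.gaussian δ)}) atTop (𝓝 0)

/-- A fixed probability density `φ` on `ℝ` and scales `σ_l > 0` with `∑_{l,k} σ_l² < ∞`. -/
structure ScaledDensities {S : ℕ} (B : RegularBasis S) where
  φ : ℝ → ℝ
  measurable_φ : Measurable φ
  φ_nonneg : ∀ x, 0 ≤ φ x
  lintegral_φ : ∫⁻ x, ENNReal.ofReal (φ x) = 1
  σ : ℤ → ℝ
  σ_pos : ∀ l ∈ B.𝓛, 0 < σ l
  summable_σ : Summable fun i : B.Index => σ i.1 ^ 2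

namespace ScaledDensities

variable {S : ℕ} {B : RegularBasis S} (Q : ScaledDensities B)

/-- The law `π_{lk}` on `ℝ` with density `φ_{lk} = σ_l⁻¹ φ(· / σ_l)`. -/
def coordLaw (i : B.Index) : Measure ℝ :=
  volume.withDensity fun x => ENNReal.ofReal ((Q.σ i.1)⁻¹ * Q.φ (x / Q.σ i.1))

instance (i : B.Index) : IsProbabilityMeasure (Q.coordLaw i) := by
  have hσ : 0 < Q.σ i.1 := Q.σ_pos _ i.1.2
  have hm : Measurable fun x => ENNReal.ofReal (Q.φ x) := Q.measurable_φ.ennreal_ofReal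
  refine ⟨?_⟩
  rw [coordLaw, withDensity_apply _ MeasurableSet.univ, Measure.restrict_univ]
  simp_rw [ENNReal.ofReal_mul (inv_nonneg.2 hσ.le), div_eq_mul_inv]
  rw [lintegral_const_mul' _ _ ENNReal.ofReal_ne_top,
    ← lintegral_map hm (measurable_id'.mul_const (Q.σ i.1)⁻¹)]
  have := Real.map_volume_mul_right (inv_ne_zero hσ.ne')
  simp only [this, inv_inv, lintegral_smul_measure, Q.lintegral_φ, abs_of_pos hσ,
    smul_eq_mul, mul_one]
  rw [← ENNReal.ofReal_mul (inv_nonneg.2 hσ.le), inv_mul_cancel₀ hσ.ne', ENNReal.ofReal_one]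

/-- The product prior `Π = ⨂ π_{lk}` on `L²`: the law of `∑ θ_{lk} ψ_{lk}` with independent
`θ_{lk} ∼ π_{lk}`. -/
def prior : Measure L2 := (Measure.infinitePi Q.coordLaw).map B.synthesis

instance : IsProbabilityMeasure Q.prior :=
  Measure.isProbabilityMeasure_map B.measurable_synthesis.aemeasurable

end ScaledDensities

end

end WhiteNoise

open WhiteNoise

/-! The prior and the noise are products over the indices `(l,k)`, hence so is the posterior. Put `t
= 1/√n`, let `ρ` be the prior density of one coordinate and `x = θ₀ + t w` its observation. The
posterior law of `(θ - x)/t` has density `h ↦ ρ (x + t h) / Z` with respect to `N(0,1)`, where `Z`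
is the Gaussian mean of the numerator. As `t → 0`, continuity and positivity of `ρ` at `θ₀` send
this density to `1`. Finitely many coordinates therefore converge in `L¹` of the density
(`tendsto_localDensity`, `tendsto_posteriorDiscrepancy`).

The remaining coordinates are controlled in the norm of `H(δ)`: a bounded Lipschitz function changes
little when they are set to zero, provided that their weighted second moment is small. The weights
are summable because `δ > 1/2` (`summable_weight`), so it is enough to bound the expected posterior
second moment of a single coordinate uniformly in `n` and in `(l,k)`. This is
`exists_lintegral_sq_localPosterior_le`. It separates prior scales that are large relative to `t`,
where `c ≤ φ ≤ C` suffices, from small ones, where the second moment of `φ` is used. Markov's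
inequality then makes the tails small with high probability.

A posterior is determined only up to null sets of the marginal law of the data, whereas the claim
concerns the law under `f₀`. Prior draws are almost surely square-summable, so Cameron–Martin makes
the second law absolutely continuous with respect to the first
(`map_gaussianSeq_absolutelyContinuous`), and the product formula for the posterior holds almost
surely under `f₀`. -/

namespace MeasureTheory.Measure

/-! ### Infinite products of measures, densities and kernels -/

variable {ι : Type*} {X Y : ι → Type*} [∀ i, MeasurableSpace (X i)] [∀ i, MeasurableSpace (Y i)]

/-- The integral of a finite product of functions of single coordinates. -/
theorem lintegral_infinitePi_prod (μ : ∀ i, Measure (X i)) [∀ i, IsProbabilityMeasure (μ i)]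
    (s : Finset ι) {f : ∀ i, X i → ENNReal} (hf : ∀ i, Measurable (f i)) :
    ∫⁻ x, ∏ i ∈ s, f i (x i) ∂infinitePi μ = ∏ i ∈ s, ∫⁻ y, f i y ∂μ i := by
  rw [lintegral_prod_eq_prod_lintegral_of_indepFun s (fun i (x : ∀ i, X i) => f i (x i))
    (iIndepFun_infinitePi hf) (fun i => (hf i).comp (measurable_pi_apply i))]
  refine Finset.prod_congr rfl fun i _ => ?_
  exact (measurePreserving_eval_infinitePi μ i).lintegral_comp (hf i)

/-- The set-integral over a box of a finite product of functions of single coordinates. -/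
theorem setLIntegral_infinitePi_prod (μ : ∀ i, Measure (X i)) [∀ i, IsProbabilityMeasure (μ i)]
    (s : Finset ι) {f : ∀ i, X i → ENNReal} (hf : ∀ i, Measurable (f i))
    {t : ∀ i, Set (X i)} (ht : ∀ i, MeasurableSet (t i)) :
    ∫⁻ x in (s : Set ι).pi t, ∏ i ∈ s, f i (x i) ∂infinitePi μ
      = ∏ i ∈ s, ∫⁻ y in t i, f i y ∂μ i := by
  classical
  rw [← lintegral_indicator (.pi s.countable_toSet fun i _ => ht i)]
  simp_rw [← lintegral_indicator (ht _)]
  rw [← lintegral_infinitePi_prod μ s fun i => (hf i).indicator (ht i)]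
  refine lintegral_congr fun x => ?_
  by_cases hx : x ∈ (s : Set ι).pi t
  · rw [indicator_of_mem hx]
    exact Finset.prod_congr rfl fun i hi => (indicator_of_mem (hx i hi) _).symm
  · rw [indicator_of_notMem hx]
    simp only [Set.mem_pi, not_forall] at hx
    obtain ⟨i, hi, hxi⟩ := hx
    exact (Finset.prod_eq_zero (Finset.mem_coe.1 hi) (indicator_of_notMem hxi _)).symm

/-- The marginals of a product of measures with densities. -/
theorem map_restrict_infinitePi_withDensity (μ : ∀ i, Measure (X i))
    [∀ i, IsProbabilityMeasure (μ i)] {f : ∀ i, X i → ENNReal} (hf : ∀ i, Measurable (f i))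
    [∀ i, IsProbabilityMeasure ((μ i).withDensity (f i))] (s : Finset ι) :
    (infinitePi fun i => (μ i).withDensity (f i)).map s.restrict
      = ((infinitePi μ).withDensity fun x => ∏ i ∈ s, f i (x i)).map s.restrict := by
  classical
  rw [infinitePi_map_restrict]
  refine pi_eq fun t ht => ?_
  let t' : ∀ i, Set (X i) := fun i => if h : i ∈ s then t ⟨i, h⟩ else univ
  have ht' : ∀ i, MeasurableSet (t' i) := fun i => by
    by_cases h : i ∈ s
    · simp only [t', dif_pos h]; exact ht _
    · simp only [t', dif_neg h]; exact .univ
  have hpre : s.restrict ⁻¹' (univ.pi t) = (s : Set ι).pi t' := by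
    ext x
    simp only [mem_preimage, Finset.restrict, Set.mem_pi, Finset.mem_coe,
      Subtype.forall]
    exact forall₂_congr fun i hi => by simp [t', hi]
  rw [map_apply (Finset.measurable_restrict s) (.univ_pi ht), hpre,
    withDensity_apply _ (.pi s.countable_toSet fun i _ => ht' i),
    setLIntegral_infinitePi_prod μ s hf ht', ← Finset.prod_attach]
  refine Finset.prod_congr rfl fun i _ => ?_
  rw [withDensity_apply _ (ht i)]
  simp [t']

/-- The product of Markov kernels acting on single coordinates. -/
noncomputable def kernelInfinitePi (κ : ∀ i, Kernel (X i) (Y i)) [∀ i, IsMarkovKernel (κ i)] :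
    Kernel (∀ i, X i) (∀ i, Y i) where
  toFun x := infinitePi fun i => κ i (x i)
  measurable' := by
    -- On a cylinder the product measure is a finite product of measurable functions of `x`, and
    -- cylinders over boxes form a generating π-system.
    refine Measurable.measure_of_isPiSystem_of_isProbabilityMeasure
      generateFrom_squareCylinders.symm
      (isPiSystem_squareCylinders (fun _ => MeasurableSpace.isPiSystem_measurableSet) (by simp)) ?_
    rintro _ ⟨s, t, ht, rfl⟩
    simp only [mem_univ_pi, mem_ofPred_eq] at ht
    simp_rw [infinitePi_pi _ fun i _ => ht i]
    exact Finset.measurable_prod _ fun i _ =>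
      ((κ i).measurable_coe (ht i)).comp (measurable_pi_apply i)

theorem kernelInfinitePi_apply (κ : ∀ i, Kernel (X i) (Y i)) [∀ i, IsMarkovKernel (κ i)]
    (x : ∀ i, X i) : kernelInfinitePi κ x = infinitePi fun i => κ i (x i) := rfl

instance (κ : ∀ i, Kernel (X i) (Y i)) [∀ i, IsMarkovKernel (κ i)] :
    IsMarkovKernel (kernelInfinitePi κ) :=
  ⟨fun x => by rw [kernelInfinitePi_apply]; infer_instance⟩

/-- The composition-product of product measures and kernels is a product measure. -/
theorem map_infinitePi_compProd_kernelInfinitePi (μ : ∀ i, Measure (X i))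
    [∀ i, IsProbabilityMeasure (μ i)] (κ : ∀ i, Kernel (X i) (Y i)) [∀ i, IsMarkovKernel (κ i)] :
    (infinitePi μ ⊗ₘ kernelInfinitePi κ).map (fun p i => (p.1 i, p.2 i))
      = infinitePi fun i => μ i ⊗ₘ κ i := by
  refine eq_infinitePi _ fun s t ht => ?_
  have hm : MeasurableSet ((s : Set ι).pi t) := .pi s.countable_toSet fun i _ => ht i
  have hz : Measurable fun (p : (∀ i, X i) × ∀ i, Y i) i => (p.1 i, p.2 i) := by fun_prop
  rw [map_apply hz hm, compProd_apply (hz hm)]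
  -- The section of a box of pairs at `x` is the box of the sections at `x i`.
  have hslice : ∀ x : ∀ i, X i,
      kernelInfinitePi κ x (Prod.mk x ⁻¹' ((fun (p : (∀ i, X i) × ∀ i, Y i) i =>
        (p.1 i, p.2 i)) ⁻¹' (s : Set ι).pi t)) = ∏ i ∈ s, κ i (x i) (Prod.mk (x i) ⁻¹' t i) := by
    intro x
    rw [← infinitePi_pi (fun i => κ i (x i)) fun i _ => measurable_prodMk_left (ht i)]
    rfl
  simp_rw [hslice]
  rw [lintegral_infinitePi_prod μ s (f := fun i y => κ i y (Prod.mk y ⁻¹' t i))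
    fun i => Kernel.measurable_kernel_prodMk_left (ht i)]
  exact Finset.prod_congr rfl fun i _ => (compProd_apply (ht i)).symm

/-- Independent copies: the product of two product measures is a product measure. -/
theorem map_infinitePi_prod_infinitePi (μ : ∀ i, Measure (X i))
    [∀ i, IsProbabilityMeasure (μ i)] (ν : ∀ i, Measure (Y i)) [∀ i, IsProbabilityMeasure (ν i)] :
    ((infinitePi μ).prod (infinitePi ν)).map (fun p i => (p.1 i, p.2 i))
      = infinitePi fun i => (μ i).prod (ν i) := by
  have h := map_infinitePi_compProd_kernelInfinitePi μ fun i => Kernel.const (X i) (ν i)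
  have hk : kernelInfinitePi (fun i => Kernel.const (X i) (ν i))
      = Kernel.const _ (infinitePi ν) := by
    ext1 x; rfl
  simpa only [hk, compProd_const] using h

end MeasureTheory.Measure

/-! ### Absolute continuity of Gaussian product measures under square-summable shifts -/

namespace MeasureTheory.Measure

/-- A measure on a product space is absolutely continuous with respect to `μ` if on cylinders it is
bounded by a multiple of the square root of `μ`. -/
theorem absolutelyContinuous_of_cylinder_le {ι : Type*} {X : ι → Type*}
    [∀ i, MeasurableSpace (X i)] {μ ν : Measure (∀ i, X i)} [IsFiniteMeasure μ]
    [IsFiniteMeasure ν] {K : ENNReal} (hK : K ≠ ⊤)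
    (h : ∀ (s : Finset ι) (S : Set (∀ i : s, X i)), MeasurableSet S →
      ν (cylinder s S) ≤ K * μ (cylinder s S) ^ (1 / 2 : ℝ)) : ν ≪ μ := by
  refine AbsolutelyContinuous.mk fun A hA hμA => ?_
  have key : ∀ ε : ENNReal, 0 < ε → ν A ≤ K * ε ^ (1 / 2 : ℝ) + ε := by
    intro ε hε
    -- Approximating with respect to `μ + ν` makes one cylinder close to `A` for both measures at
    -- once.
    obtain ⟨t, ht, htA⟩ := exists_measure_symmDiff_lt_of_generateFrom_isSetRing (μ := μ + ν)
      (isSetRing_measurableCylinders (α := X))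
      ⟨{univ}, by simp, by
        simpa using univ_mem_measurableCylinders X, by simp⟩
      generateFrom_measurableCylinders.symm hA hε
    obtain ⟨s, S, hS, rfl⟩ := (mem_measurableCylinders _).1 ht
    rw [add_apply] at htA
    have h1 : μ (cylinder s S) ≤ ε := calc
      μ (cylinder s S) ≤ μ (A ∪ symmDiff (cylinder s S) A) := by
        refine measure_mono fun x hx => ?_
        by_cases hxA : x ∈ A
        · exact Or.inl hxA
        · exact Or.inr (Or.inl ⟨hx, hxA⟩)
      _ ≤ μ A + μ (symmDiff (cylinder s S) A) := measure_union_le _ _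
      _ ≤ ε := by rw [hμA, zero_add]; exact (le_self_add.trans htA.le)
    calc ν A ≤ ν (cylinder s S ∪ symmDiff (cylinder s S) A) := by
          refine measure_mono fun x hx => ?_
          by_cases hxs : x ∈ cylinder s S
          · exact Or.inl hxs
          · exact Or.inr (Or.inr ⟨hx, hxs⟩)
      _ ≤ ν (cylinder s S) + ν (symmDiff (cylinder s S) A) := measure_union_le _ _
      _ ≤ K * ε ^ (1 / 2 : ℝ) + ε := by
          refine add_le_add ((h s S hS).trans ?_) (le_add_self.trans htA.le)
          gcongr
  have hlim : Tendsto (fun ε : ENNReal => K * ε ^ (1 / 2 : ℝ) + ε) (𝓝[>] 0) (𝓝 0) := by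
    have h1 : Tendsto (fun ε : ENNReal => K * ε ^ (1 / 2 : ℝ) + ε) (𝓝 0)
        (𝓝 (K * 0 ^ (1 / 2 : ℝ) + 0)) :=
      (ENNReal.Tendsto.const_mul (ENNReal.continuous_rpow_const.tendsto 0) (Or.inr hK)).add
        tendsto_id
    rw [ENNReal.zero_rpow_of_pos (by norm_num), mul_zero, add_zero] at h1
    exact h1.mono_left nhdsWithin_le_nhds
  exact le_antisymm
    (ge_of_tendsto hlim (eventually_nhdsWithin_of_forall fun ε hε => key ε hε)) zero_le
end MeasureTheory.Measure

namespace ProbabilityTheory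

/-- The density of `N(g, 1)` with respect to `N(0, 1)`. -/
noncomputable def gaussianShiftDensity (g x : ℝ) : ENNReal :=
  ENNReal.ofReal (Real.exp (g * x - g ^ 2 / 2))

theorem measurable_gaussianShiftDensity (g : ℝ) : Measurable (gaussianShiftDensity g) := by
  unfold gaussianShiftDensity; fun_prop

theorem gaussianReal_withDensity_shift (g : ℝ) :
    (gaussianReal 0 1).withDensity (gaussianShiftDensity g) = gaussianReal g 1 := by
  rw [gaussianReal_of_var_ne_zero _ one_ne_zero, gaussianReal_of_var_ne_zero _ one_ne_zero,
    ← withDensity_mul _ (measurable_gaussianPDF _ _) (measurable_gaussianShiftDensity g)]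
  congr 1
  ext x
  simp only [Pi.mul_apply, gaussianPDF, gaussianShiftDensity]
  rw [← ENNReal.ofReal_mul (gaussianPDFReal_nonneg _ _ _)]
  congr 1
  simp only [gaussianPDFReal, mul_assoc, ← Real.exp_add, NNReal.coe_one]
  congr 2
  ring

/-- Squaring the density doubles the shift at the cost of the factor `exp (g ^ 2)`. Over many
coordinates these factors multiply to the exponential of a convergent sum. -/
theorem lintegral_gaussianShiftDensity_sq (g : ℝ) :
    ∫⁻ x, gaussianShiftDensity g x ^ 2 ∂gaussianReal 0 1 = ENNReal.ofReal (Real.exp (g ^ 2)) := by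
  have h : ∀ x, gaussianShiftDensity g x ^ 2
      = ENNReal.ofReal (Real.exp (g ^ 2)) * gaussianShiftDensity (2 * g) x := by
    intro x
    unfold gaussianShiftDensity
    rw [← ENNReal.ofReal_pow (Real.exp_nonneg _), ← ENNReal.ofReal_mul (Real.exp_nonneg _),
      ← Real.exp_nat_mul, ← Real.exp_add]
    congr 2
    push_cast
    ring
  simp_rw [h]
  rw [lintegral_const_mul _ (measurable_gaussianShiftDensity _), ← setLIntegral_univ,
    ← withDensity_apply _ .univ, gaussianReal_withDensity_shift, measure_univ, mul_one]

/-- **Cameron–Martin**: a square-summable shift of the standard Gaussian product measure is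
absolutely continuous with respect to it. -/
theorem infinitePi_gaussianReal_absolutelyContinuous {ι : Type*} {g : ι → ℝ}
    (hg : Summable fun i => g i ^ 2) :
    Measure.infinitePi (fun i => gaussianReal (g i) 1)
      ≪ Measure.infinitePi (fun _ : ι => gaussianReal 0 1) := by
  have hinst : ∀ i, IsProbabilityMeasure
      ((gaussianReal 0 1).withDensity (gaussianShiftDensity (g i))) := fun i => by
    rw [gaussianReal_withDensity_shift]; infer_instance
  rw [show (fun i => gaussianReal (g i) 1)
    = fun i => (gaussianReal 0 1).withDensity (gaussianShiftDensity (g i)) from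
      funext fun i => (gaussianReal_withDensity_shift (g i)).symm]
  -- The constant bounds the `L²` norm of the density on every finite set of coordinates;
  -- Cauchy–Schwarz against the indicator of the cylinder gives the exponent `1/2`.
  refine Measure.absolutelyContinuous_of_cylinder_le
    (K := ENNReal.ofReal (Real.exp (∑' i, g i ^ 2)) ^ (1 / 2 : ℝ))
    (ENNReal.rpow_ne_top_of_nonneg (by norm_num) ENNReal.ofReal_ne_top) fun s S hS => ?_
  have hc : MeasurableSet (cylinder s S) := MeasurableSet.cylinder (α := fun _ => ℝ) s hS
  set μ := Measure.infinitePi fun _ : ι => gaussianReal 0 1 with hμ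
  set L : (ι → ℝ) → ENNReal := fun x => ∏ i ∈ s, gaussianShiftDensity (g i) (x i) with hL
  have hLm : Measurable L := Finset.measurable_prod _ fun i _ =>
    (measurable_gaussianShiftDensity (g i)).comp (measurable_pi_apply i)
  have h1 : Measure.infinitePi
      (fun i => (gaussianReal 0 1).withDensity (gaussianShiftDensity (g i))) (cylinder s S)
      = ∫⁻ x, (cylinder s S).indicator 1 x * L x ∂μ := by
    rw [cylinder, ← Measure.map_apply (Finset.measurable_restrict s) hS,
      Measure.map_restrict_infinitePi_withDensity _
        (fun i => measurable_gaussianShiftDensity (g i)),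
      Measure.map_apply (Finset.measurable_restrict s) hS, ← cylinder, withDensity_apply _ hc,
      ← lintegral_indicator hc]
    refine lintegral_congr fun x => ?_
    by_cases hx : x ∈ cylinder s S <;> simp [hx, hL]
  rw [h1]
  refine (ENNReal.lintegral_mul_le_Lp_mul_Lq μ Real.HolderConjugate.two_two
    (measurable_one.indicator hc).aemeasurable hLm.aemeasurable).trans ?_
  rw [mul_comm]
  have h2 : ∫⁻ x, L x ^ (2 : ℝ) ∂μ ≤ ENNReal.ofReal (Real.exp (∑' i, g i ^ 2)) := by
    have : ∀ x, L x ^ (2 : ℝ) = ∏ i ∈ s, gaussianShiftDensity (g i) (x i) ^ 2 := fun x => by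
      rw [ENNReal.rpow_two, hL, Finset.prod_pow]
    simp_rw [this]
    rw [hμ, Measure.lintegral_infinitePi_prod _ s (f := fun i y => gaussianShiftDensity (g i) y ^ 2)
      fun i => (measurable_gaussianShiftDensity (g i)).pow_const 2]
    simp_rw [lintegral_gaussianShiftDensity_sq]
    rw [← ENNReal.ofReal_prod_of_nonneg fun i _ => Real.exp_nonneg _, ← Real.exp_sum]
    refine ENNReal.ofReal_le_ofReal (Real.exp_le_exp.2 ?_)
    exact hg.sum_le_tsum s fun i _ => sq_nonneg _
  have h3 : ∫⁻ x, (cylinder s S).indicator (1 : (ι → ℝ) → ENNReal) x ^ (2 : ℝ) ∂μ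
      = μ (cylinder s S) := by
    rw [← lintegral_indicator_one hc]
    refine lintegral_congr fun x => ?_
    by_cases hx : x ∈ cylinder s S <;> simp [hx]
  rw [h3]
  gcongr

end ProbabilityTheory

/-! ### Bayes formula for one coordinate -/

namespace WhiteNoise

noncomputable section

/-- The density at `x` of `θ + t w`, when `θ` has density `ρ` and `w` is standard normal. -/
def evidence (ρ : ℝ → ENNReal) (t x : ℝ) : ENNReal := ∫⁻ h, ρ (x + t * h) ∂gaussianReal 0 1

/-- The density, with respect to `N(0,1)`, of the posterior law of `(θ - x) / t` given
`θ + t w = x`. -/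
def localDensity (ρ : ℝ → ENNReal) (t x h : ℝ) : ENNReal :=
  open scoped Classical in
  if evidence ρ t x = 0 ∨ evidence ρ t x = ⊤ then 1 else ρ (x + t * h) / evidence ρ t x

/-- The posterior law of `(θ - x) / t` given `θ + t w = x`. -/
def localPosterior (ρ : ℝ → ENNReal) (t : ℝ) : Kernel ℝ ℝ :=
  Kernel.withDensity (Kernel.const ℝ (gaussianReal 0 1)) (localDensity ρ t)

variable {ρ : ℝ → ENNReal}

theorem measurable_evidence (hρ : Measurable ρ) (t : ℝ) : Measurable (evidence ρ t) := by
  have : Measurable fun p : ℝ × ℝ => ρ (p.1 + t * p.2) := by fun_prop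
  exact this.lintegral_prod_right'

theorem measurable_localDensity (hρ : Measurable ρ) (t : ℝ) :
    Measurable (Function.uncurry (localDensity ρ t)) := by
  classical
  have hZ := measurable_evidence hρ t
  have hs : MeasurableSet {p : ℝ × ℝ | evidence ρ t p.1 = 0 ∨ evidence ρ t p.1 = ⊤} :=
    ((hZ.comp measurable_fst) (measurableSet_singleton 0)).union
      ((hZ.comp measurable_fst) (measurableSet_singleton ⊤))
  exact Measurable.ite hs measurable_const
    ((by fun_prop : Measurable fun p : ℝ × ℝ => ρ (p.1 + t * p.2)).div (hZ.comp measurable_fst))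

theorem localPosterior_apply (hρ : Measurable ρ) (t x : ℝ) :
    localPosterior ρ t x = (gaussianReal 0 1).withDensity (localDensity ρ t x) :=
  Kernel.withDensity_apply _ (measurable_localDensity hρ t) x

theorem localDensity_of_ne {t x : ℝ} (h0 : evidence ρ t x ≠ 0) (h1 : evidence ρ t x ≠ ⊤) (h : ℝ) :
    localDensity ρ t x h = ρ (x + t * h) / evidence ρ t x := by
  simp [localDensity, h0, h1]

/-- Where the evidence is `0` or `⊤`, the default density `1` yields `N(0,1)`, so the total mass is
one at every `x` and not only at almost every one. -/
theorem isMarkovKernel_localPosterior (hρ : Measurable ρ) (t : ℝ) :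
    IsMarkovKernel (localPosterior ρ t) := by
  refine ⟨fun x => ⟨?_⟩⟩
  rw [localPosterior_apply hρ, withDensity_apply _ .univ, setLIntegral_univ]
  by_cases hx : evidence ρ t x = 0 ∨ evidence ρ t x = ⊤
  · simp [localDensity, hx]
  · push Not at hx
    simp_rw [localDensity_of_ne hx.1 hx.2, div_eq_mul_inv]
    rw [lintegral_mul_const _ (by fun_prop)]
    exact ENNReal.mul_inv_cancel hx.1 hx.2

/-- Change of variables from `(θ, w)` to `(x, h) = (θ + t w, -w)`. -/
theorem prod_gaussianReal_preimage (hρ : Measurable ρ)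
    [IsProbabilityMeasure (volume.withDensity ρ)] (t : ℝ) {A : Set (ℝ × ℝ)}
    (hA : MeasurableSet A) :
    ((volume.withDensity ρ).prod (gaussianReal 0 1)) ((fun p => (p.1 + t * p.2, -p.2)) ⁻¹' A)
      = ∫⁻ x, ∫⁻ h, A.indicator 1 (x, h) * ρ (x + t * h) ∂gaussianReal 0 1 := by
  have hT : Measurable fun p : ℝ × ℝ => (p.1 + t * p.2, -p.2) := by fun_prop
  have hI : Measurable (A.indicator (1 : ℝ × ℝ → ENNReal)) := measurable_one.indicator hA
  have hneg : MeasurePreserving (fun w : ℝ => -w) (gaussianReal 0 1) (gaussianReal 0 1) :=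
    ⟨measurable_neg, by simpa using gaussianReal_map_neg (μ := 0) (v := 1)⟩
  rw [Measure.prod_apply_symm (hT hA)]
  have h1 : ∀ w : ℝ, volume.withDensity ρ
      ((fun θ => (θ, w)) ⁻¹' ((fun p => (p.1 + t * p.2, -p.2)) ⁻¹' A))
      = ∫⁻ x, A.indicator 1 (x, -w) * ρ (x + t * -w) := by
    intro w
    have hm : MeasurableSet ((fun θ => (θ, w)) ⁻¹' ((fun p : ℝ × ℝ =>
      (p.1 + t * p.2, -p.2)) ⁻¹' A)) := measurable_prodMk_right (hT hA)
    rw [withDensity_apply _ hm, ← lintegral_indicator hm,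
      -- For fixed `w`, Lebesgue measure is invariant under the translation `x = θ + t w`.
      ← lintegral_add_right_eq_self (fun x => A.indicator 1 (x, -w) * ρ (x + t * -w)) (t * w)]
    refine lintegral_congr fun θ => ?_
    rw [show θ + t * w + t * -w = θ by ring]
    by_cases hθ : (θ + t * w, -w) ∈ A
    · rw [indicator_of_mem (by exact hθ), indicator_of_mem hθ]; simp
    · rw [indicator_of_notMem (by exact hθ), indicator_of_notMem hθ, zero_mul]
  simp_rw [h1]
  have hF : Measurable fun p : ℝ × ℝ => A.indicator 1 (p.2, p.1) * ρ (p.2 + t * p.1) := by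
    exact (hI.comp measurable_swap).mul (by fun_prop)
  -- The sign in `h = -w` comes from `(θ - x) / t = -w`; symmetry of the Gaussian absorbs it.
  rw [hneg.lintegral_comp (f := fun h => ∫⁻ x, A.indicator 1 (x, h) * ρ (x + t * h))
    hF.lintegral_prod_right']
  exact lintegral_lintegral_swap hF.aemeasurable

theorem lintegral_evidence (hρ : Measurable ρ) [IsProbabilityMeasure (volume.withDensity ρ)]
    (t : ℝ) : ∫⁻ x, evidence ρ t x = 1 := by
  have h := prod_gaussianReal_preimage hρ t MeasurableSet.univ
  simpa [evidence] using h.symm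

theorem isProbabilityMeasure_evidence (hρ : Measurable ρ)
    [IsProbabilityMeasure (volume.withDensity ρ)] (t : ℝ) :
    IsProbabilityMeasure (volume.withDensity (evidence ρ t)) :=
  ⟨by rw [withDensity_apply _ .univ, setLIntegral_univ, lintegral_evidence hρ]⟩

/-- One-dimensional Bayes formula: disintegration of the law of `(θ + t w, -w)`. -/
theorem map_prod_gaussianReal_eq_compProd (hρ : Measurable ρ)
    [IsProbabilityMeasure (volume.withDensity ρ)] (t : ℝ) :
    ((volume.withDensity ρ).prod (gaussianReal 0 1)).map (fun p => (p.1 + t * p.2, -p.2))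
      = volume.withDensity (evidence ρ t) ⊗ₘ localPosterior ρ t := by
  have := isMarkovKernel_localPosterior hρ t
  have := isProbabilityMeasure_evidence hρ t
  have hZ := measurable_evidence hρ t
  ext A hA
  rw [Measure.map_apply (by fun_prop) hA, prod_gaussianReal_preimage hρ t hA,
    Measure.compProd_apply hA, lintegral_withDensity_eq_lintegral_mul _ hZ
      (Kernel.measurable_kernel_prodMk_left hA)]
  have hfin : ∀ᵐ x, evidence ρ t x < ⊤ :=
    ae_lt_top hZ (by rw [lintegral_evidence hρ]; exact ENNReal.one_ne_top)
  refine lintegral_congr_ae ?_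
  filter_upwards [hfin] with x hx
  have hAx : MeasurableSet (Prod.mk x ⁻¹' A) := measurable_prodMk_left hA
  have hρx : Measurable fun h => ρ (x + t * h) := by fun_prop
  have hl : ∫⁻ h, A.indicator 1 (x, h) * ρ (x + t * h) ∂gaussianReal 0 1
      = ∫⁻ h in Prod.mk x ⁻¹' A, ρ (x + t * h) ∂gaussianReal 0 1 := by
    rw [← lintegral_indicator hAx]
    refine lintegral_congr fun h => ?_
    by_cases hh : (x, h) ∈ A
    · rw [indicator_of_mem hh, indicator_of_mem (by exact hh)]; simp
    · rw [indicator_of_notMem hh, indicator_of_notMem (by exact hh), zero_mul]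
  rw [hl, Pi.mul_apply]
  -- Zero evidence forces the numerator to have zero integral too, so the default value of the
  -- kernel there carries no mass.
  by_cases h0 : evidence ρ t x = 0
  · rw [h0, zero_mul]
    exact le_antisymm ((setLIntegral_le_lintegral _ _).trans h0.le) zero_le
  · rw [localPosterior_apply hρ, withDensity_apply _ hAx]
    simp_rw [localDensity_of_ne h0 hx.ne, div_eq_mul_inv]
    rw [lintegral_mul_const _ hρx, mul_comm, mul_assoc, ENNReal.inv_mul_cancel h0 hx.ne, mul_one]

end

end WhiteNoise

/-! ### Gaussian estimates for posterior second moments -/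

namespace ProbabilityTheory

theorem lintegral_gaussianReal_shift {f : ℝ → ENNReal} (hf : Measurable f) (w : ℝ) :
    ∫⁻ h, f (w + h) ∂gaussianReal 0 1
      = ∫⁻ v, f v * gaussianShiftDensity w v ∂gaussianReal 0 1 := by
  have h1 : (gaussianReal 0 1).map (fun h => w + h) = gaussianReal w 1 := by
    simpa using gaussianReal_map_const_add (μ := 0) (v := 1) w
  rw [← lintegral_map hf (measurable_const_add w), h1, ← gaussianReal_withDensity_shift,
    lintegral_withDensity_eq_lintegral_mul _ (measurable_gaussianShiftDensity w) hf]
  simp_rw [Pi.mul_apply, mul_comm]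

/-- The exponential cancels the Gaussian density, leaving Lebesgue measure. -/
theorem lintegral_gaussianReal_mul_exp {f : ℝ → ENNReal} (hf : Measurable f) :
    ∫⁻ v, f v * ENNReal.ofReal (Real.exp (v ^ 2 / 2)) ∂gaussianReal 0 1
      = ENNReal.ofReal (√(2 * Real.pi))⁻¹ * ∫⁻ v, f v := by
  rw [gaussianReal_of_var_ne_zero _ one_ne_zero, lintegral_withDensity_eq_lintegral_mul _
    (measurable_gaussianPDF _ _) (by fun_prop), ← lintegral_const_mul _ hf]
  refine lintegral_congr fun v => ?_
  simp only [Pi.mul_apply, gaussianPDF, gaussianPDFReal, NNReal.coe_one, mul_one, sub_zero]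
  rw [mul_left_comm, ← ENNReal.ofReal_mul (by positivity), mul_assoc, ← Real.exp_add,
    show -v ^ 2 / 2 + v ^ 2 / 2 = 0 by ring, Real.exp_zero, mul_one, mul_comm]

theorem lintegral_sq_gaussianReal : ∫⁻ h, ENNReal.ofReal (h ^ 2) ∂gaussianReal 0 1 = 1 := by
  have h := variance_id_gaussianReal (μ := 0) (v := 1)
  rw [variance_eq_integral measurable_id.aemeasurable] at h
  simp only [id_eq, integral_id_gaussianReal, sub_zero, NNReal.coe_one] at h
  rw [← ofReal_integral_eq_lintegral_ofReal, h, ENNReal.ofReal_one]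
  · exact (memLp_id_gaussianReal 2).integrable_sq
  · exact ae_of_all _ fun x => sq_nonneg x

theorem gaussianReal_ge_volume {s : Set ℝ} (hs : MeasurableSet s) (h1 : ∀ x ∈ s, |x| ≤ 1) :
    ENNReal.ofReal (gaussianPDFReal 0 1 1) * volume s ≤ gaussianReal 0 1 s := by
  rw [gaussianReal_apply _ one_ne_zero, ← setLIntegral_const]
  refine setLIntegral_mono' hs fun x hx => ENNReal.ofReal_le_ofReal ?_
  simp only [gaussianPDFReal, NNReal.coe_one, sub_zero, mul_one]
  refine mul_le_mul_of_nonneg_left (Real.exp_le_exp.2 ?_) (by positivity)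
  have := (sq_le_one_iff_abs_le_one x).2 (h1 x hx)
  linarith

end ProbabilityTheory

namespace WhiteNoise

/-- Lower bound for the normalising constant of the local posterior. -/
theorem lintegral_shift_ge {ψ : ℝ → ENNReal} (hψ : Measurable ψ) {c r : ℝ} (hc : 0 < c)
    (hr : 0 < r) (hr1 : r ≤ 1) (hψc : ∀ v ∈ Ioo (-r) r, ENNReal.ofReal c ≤ ψ v) (w : ℝ) :
    ENNReal.ofReal (c * (r / 2 * gaussianPDFReal 0 1 1) * Real.exp (|w| * r / 2 - w ^ 2 / 2))
      ≤ ∫⁻ h, ψ (w + h) ∂gaussianReal 0 1 := by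
  have hp : 0 < gaussianPDFReal 0 1 1 := gaussianPDFReal_pos _ _ _ one_ne_zero
  rw [lintegral_gaussianReal_shift hψ]
  -- By Cameron–Martin the shift by `w` becomes the weight `exp (w v - w ^ 2 / 2)`. On the outer
  -- half of `(-r, r)` on the side of the sign of `w`, which has length `r / 2`, one has `w v ≥ |w|
  -- r / 2`. This gain is what later makes an integral over `w` converge.
  have key : ∀ s : Set ℝ, MeasurableSet s → volume s = ENNReal.ofReal (r / 2) →
      (∀ v ∈ s, v ∈ Ioo (-r) r ∧ |w| * r / 2 ≤ w * v) →
      ENNReal.ofReal (c * (r / 2 * gaussianPDFReal 0 1 1) * Real.exp (|w| * r / 2 - w ^ 2 / 2))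
      ≤ ∫⁻ v, ψ v * gaussianShiftDensity w v ∂gaussianReal 0 1 := by
    intro s hs hvol hv
    refine le_trans ?_ (setLIntegral_le_lintegral s _)
    have h1 : ∀ v ∈ s, ENNReal.ofReal (c * Real.exp (|w| * r / 2 - w ^ 2 / 2))
        ≤ ψ v * gaussianShiftDensity w v := by
      intro v hvs
      rw [ENNReal.ofReal_mul hc.le]
      refine mul_le_mul' (hψc v (hv v hvs).1) (ENNReal.ofReal_le_ofReal (Real.exp_le_exp.2 ?_))
      linarith [(hv v hvs).2]
    refine le_trans ?_ (setLIntegral_mono' hs h1)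
    rw [setLIntegral_const]
    have h2 := gaussianReal_ge_volume hs fun v hvs => by
      have := (hv v hvs).1
      rw [abs_le]; constructor <;> linarith [this.1, this.2]
    rw [hvol, ← ENNReal.ofReal_mul hp.le] at h2
    refine le_trans (le_of_eq ?_) (mul_le_mul_right h2 _)
    rw [← ENNReal.ofReal_mul (by positivity)]
    congr 1
    ring
  rcases le_total 0 w with hw | hw
  · refine key (Ioo (r / 2) r) measurableSet_Ioo ?_ fun v hv => ⟨⟨?_, hv.2⟩, ?_⟩
    · rw [Real.volume_Ioo]; congr 1; ring
    · linarith [hv.1]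
    · rw [abs_of_nonneg hw, mul_div_assoc]
      exact mul_le_mul_of_nonneg_left hv.1.le hw
  · refine key (Ioo (-r) (-(r / 2))) measurableSet_Ioo ?_ fun v hv => ⟨⟨hv.1, ?_⟩, ?_⟩
    · rw [Real.volume_Ioo]; congr 1; ring
    · linarith [hv.2]
    · rw [abs_of_nonpos hw, neg_mul, neg_div, mul_div_assoc]
      nlinarith [hv.2]

theorem lintegral_exp_neg_abs_lt_top : ∫⁻ w : ℝ, ENNReal.ofReal (Real.exp (-|w| / 2)) < ⊤ := by
  have h : ∀ w : ℝ, ENNReal.ofReal (Real.exp (-|w| / 2)) ≤ ENNReal.ofReal (8 * (1 + w ^ 2)⁻¹) := by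
    intro w
    refine ENNReal.ofReal_le_ofReal ?_
    have h1 := Real.quadratic_le_exp_of_nonneg (x := |w| / 2) (by positivity)
    rw [neg_div, Real.exp_neg, ← div_eq_mul_inv, inv_eq_one_div,
      div_le_div_iff₀ (Real.exp_pos _) (by positivity)]
    nlinarith [sq_abs w, abs_nonneg w]
  refine (lintegral_mono h).trans_lt ?_
  exact ((integrable_inv_one_add_sq.const_mul 8).lintegral_lt_top)

/-- A universal constant for the second moments of local posteriors. -/
noncomputable def momentConst : ENNReal :=
  ENNReal.ofReal (2 / gaussianPDFReal 0 1 1) * (ENNReal.ofReal (√(2 * Real.pi))⁻¹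
    * ∫⁻ w : ℝ, ENNReal.ofReal (Real.exp (-|w| / 2)))

theorem momentConst_lt_top : momentConst < ⊤ :=
  ENNReal.mul_lt_top ENNReal.ofReal_lt_top
    (ENNReal.mul_lt_top ENNReal.ofReal_lt_top lintegral_exp_neg_abs_lt_top)

/-- The case of a prior that is spread out at the noise scale. The numerator is at most `C`, the
Gaussian second moment being `1`; the denominator is at least a multiple of `c * exp (|w| / 2 - w ^
2 / 2)`. Against the Gaussian law of `w` the factor `exp (w ^ 2 / 2)` disappears, and `exp (-|w| /
2)` remains integrable. Only the ratio `C / c` enters, so the scale of the density cancels. -/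
theorem lintegral_moment_ratio_le_of_bounded {ψ : ℝ → ENNReal} (hψ : Measurable ψ) {c C : ℝ}
    (hc : 0 < c) (hC : 0 ≤ C) (hψc : ∀ v ∈ Ioo (-1 : ℝ) 1, ENNReal.ofReal c ≤ ψ v)
    (hψC : ∀ v, ψ v ≤ ENNReal.ofReal C) :
    ∫⁻ w, (∫⁻ h, ENNReal.ofReal (h ^ 2) * ψ (w + h) ∂gaussianReal 0 1)
      / (∫⁻ h, ψ (w + h) ∂gaussianReal 0 1) ∂gaussianReal 0 1
      ≤ ENNReal.ofReal (C / c) * momentConst := by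
  have hp : 0 < gaussianPDFReal 0 1 1 := gaussianPDFReal_pos _ _ _ one_ne_zero
  have h1 : ∀ w, (∫⁻ h, ENNReal.ofReal (h ^ 2) * ψ (w + h) ∂gaussianReal 0 1)
      / (∫⁻ h, ψ (w + h) ∂gaussianReal 0 1)
      ≤ ENNReal.ofReal (C / c * (2 / gaussianPDFReal 0 1 1)) *
        (ENNReal.ofReal (Real.exp (-|w| / 2)) * ENNReal.ofReal (Real.exp (w ^ 2 / 2))) := by
    intro w
    have hN : ∫⁻ h, ENNReal.ofReal (h ^ 2) * ψ (w + h) ∂gaussianReal 0 1 ≤ ENNReal.ofReal C := by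
      refine (lintegral_mono fun h => mul_le_mul_right (hψC _) _).trans ?_
      rw [lintegral_mul_const _ (by fun_prop), lintegral_sq_gaussianReal, one_mul]
    refine (ENNReal.div_le_div hN (lintegral_shift_ge hψ hc one_pos le_rfl hψc w)).trans ?_
    rw [← ENNReal.ofReal_div_of_pos (by positivity), ← ENNReal.ofReal_mul (by positivity),
      ← ENNReal.ofReal_mul (by positivity)]
    refine ENNReal.ofReal_le_ofReal (le_of_eq ?_)
    rw [← Real.exp_add, show -|w| / 2 + w ^ 2 / 2 = -(|w| * 1 / 2 - w ^ 2 / 2) by ring,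
      Real.exp_neg]
    field_simp
  refine (lintegral_mono h1).trans (le_of_eq ?_)
  rw [lintegral_const_mul _ (by fun_prop), lintegral_gaussianReal_mul_exp (by fun_prop),
    ENNReal.ofReal_mul (by positivity), momentConst, mul_assoc]

/-- The case of a prior that is narrow at the noise scale. Split `h = (w + h) - w`. The `w` part
contributes `2`. In the other part the factors `exp (-w ^ 2 / 2)` of numerator and denominator
cancel; integrating `exp (w v)` over `w` gives `exp (v ^ 2 / 2)`, which cancels the Gaussian density
of `v` and leaves the Lebesgue second moment of `ψ`. -/
theorem lintegral_moment_ratio_le_of_moment {ψ : ℝ → ENNReal} (hψ : Measurable ψ) {c r : ℝ}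
    (hc : 0 < c) (hr : 0 < r) (hr1 : r ≤ 1) (hψc : ∀ v ∈ Ioo (-r) r, ENNReal.ofReal c ≤ ψ v) :
    ∫⁻ w, (∫⁻ h, ENNReal.ofReal (h ^ 2) * ψ (w + h) ∂gaussianReal 0 1)
      / (∫⁻ h, ψ (w + h) ∂gaussianReal 0 1) ∂gaussianReal 0 1
      ≤ 2 + ENNReal.ofReal (4 / (c * r * gaussianPDFReal 0 1 1)) *
        ∫⁻ v, ENNReal.ofReal (v ^ 2) * ψ v := by
  have hp : 0 < gaussianPDFReal 0 1 1 := gaussianPDFReal_pos _ _ _ one_ne_zero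
  have h1 : ∀ w, (∫⁻ h, ENNReal.ofReal (h ^ 2) * ψ (w + h) ∂gaussianReal 0 1)
      / (∫⁻ h, ψ (w + h) ∂gaussianReal 0 1)
      ≤ 2 * ENNReal.ofReal (w ^ 2) + ENNReal.ofReal (4 / (c * r * gaussianPDFReal 0 1 1)) *
        ∫⁻ v, ENNReal.ofReal (v ^ 2) * ψ v * ENNReal.ofReal (Real.exp (w * v))
          ∂gaussianReal 0 1 := by
    intro w
    set Z := ∫⁻ h, ψ (w + h) ∂gaussianReal 0 1 with hZ
    have hN : ∫⁻ h, ENNReal.ofReal (h ^ 2) * ψ (w + h) ∂gaussianReal 0 1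
        ≤ 2 * ENNReal.ofReal (w ^ 2) * Z
          + 2 * ∫⁻ h, ENNReal.ofReal ((w + h) ^ 2) * ψ (w + h) ∂gaussianReal 0 1 := by
      rw [hZ, ← lintegral_const_mul _ (by fun_prop), ← lintegral_const_mul _ (by fun_prop),
        ← lintegral_add_left (by fun_prop)]
      refine lintegral_mono fun h => ?_
      rw [← mul_assoc 2 (ENNReal.ofReal ((w + h) ^ 2)), ← add_mul]
      refine mul_le_mul_left ?_ _
      rw [← ENNReal.ofReal_ofNat 2, ← ENNReal.ofReal_mul (by norm_num),
        ← ENNReal.ofReal_mul (by norm_num), ← ENNReal.ofReal_add (by positivity) (by positivity)]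
      refine ENNReal.ofReal_le_ofReal ?_
      -- The identity is `2 w² + 2 (w + h)² - h² = (2 w + h)²`.
      nlinarith [sq_nonneg (2 * w + h)]
    have hS := lintegral_gaussianReal_shift (f := fun v => ENNReal.ofReal (v ^ 2) * ψ v)
      (by fun_prop) w
    rw [hS] at hN
    refine (ENNReal.div_le_div_right hN _).trans ?_
    rw [ENNReal.add_div]
    refine add_le_add (ENNReal.div_le_of_le_mul le_rfl) ?_
    have hlow := lintegral_shift_ge hψ hc hr hr1 hψc w
    -- The gain `|w| r / 2` is dropped: integrability in `w` now comes from the second moment of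
    -- `ψ`.
    have hlow' : ENNReal.ofReal (c * (r / 2 * gaussianPDFReal 0 1 1) * Real.exp (-(w ^ 2 / 2)))
        ≤ Z := by
      refine le_trans (ENNReal.ofReal_le_ofReal ?_) hlow
      gcongr
      have : 0 ≤ |w| * r / 2 := by positivity
      linarith
    refine (ENNReal.div_le_div_left hlow' _).trans ?_
    rw [div_eq_mul_inv, ← ENNReal.ofReal_inv_of_pos (by positivity), mul_comm, ← mul_assoc,
      ← ENNReal.ofReal_ofNat 2, ← ENNReal.ofReal_mul (by positivity),
      ← lintegral_const_mul _ (by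
        have := measurable_gaussianShiftDensity w
        fun_prop), ← lintegral_const_mul _ (by fun_prop)]
    refine lintegral_mono fun v => le_of_eq ?_
    rw [mul_left_comm, mul_left_comm (ENNReal.ofReal (4 / _)), gaussianShiftDensity,
      ← ENNReal.ofReal_mul (by positivity), ← ENNReal.ofReal_mul (by positivity)]
    congr 2
    rw [Real.exp_sub, Real.exp_neg]
    field_simp
    ring
  have hmeas : Measurable fun p : ℝ × ℝ =>
      ENNReal.ofReal (p.2 ^ 2) * ψ p.2 * ENNReal.ofReal (Real.exp (p.1 * p.2)) := by fun_prop
  refine (lintegral_mono h1).trans ?_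
  rw [lintegral_add_left (by fun_prop), lintegral_const_mul _ (by fun_prop),
    lintegral_sq_gaussianReal, mul_one, lintegral_const_mul _ hmeas.lintegral_prod_right',
    lintegral_lintegral_swap hmeas.aemeasurable]
  refine add_le_add_right (mul_le_mul_right ?_ _) _
  have h2 : ∀ v : ℝ, ∫⁻ w, ENNReal.ofReal (v ^ 2) * ψ v * ENNReal.ofReal (Real.exp (w * v))
      ∂gaussianReal 0 1
      = ENNReal.ofReal (v ^ 2) * ψ v * ENNReal.ofReal (Real.exp (v ^ 2 / 2)) := by
    intro v
    rw [lintegral_const_mul _ (by fun_prop)]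
    congr 1
    have h3 : ∀ w, ENNReal.ofReal (Real.exp (w * v))
        = gaussianShiftDensity v w * ENNReal.ofReal (Real.exp (v ^ 2 / 2)) := by
      intro w
      rw [gaussianShiftDensity, ← ENNReal.ofReal_mul (Real.exp_nonneg _), ← Real.exp_add]
      congr 2
      ring
    simp_rw [h3]
    rw [lintegral_mul_const _ (measurable_gaussianShiftDensity v), ← setLIntegral_univ,
      ← withDensity_apply _ .univ, gaussianReal_withDensity_shift, measure_univ, one_mul]
  simp_rw [h2]
  rw [lintegral_gaussianReal_mul_exp (by fun_prop)]
  -- The leftover constant `(2π)^(-1/2)` is at most one.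
  refine mul_le_of_le_one_left' ?_
  rw [ENNReal.ofReal_le_one]
  refine inv_le_one_of_one_le₀ (Real.one_le_sqrt.2 ?_)
  linarith [Real.pi_gt_three]

end WhiteNoise

/-! ### Scaled prior densities: uniform moment bound and local limit -/

namespace WhiteNoise

noncomputable section

/-- The density `σ⁻¹ φ(· / σ)`. -/
def scaledDensity (φ : ℝ → ℝ) (σ x : ℝ) : ENNReal := ENNReal.ofReal (σ⁻¹ * φ (x / σ))

theorem measurable_scaledDensity {φ : ℝ → ℝ} (hφ : Measurable φ) (σ : ℝ) :
    Measurable (scaledDensity φ σ) := by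
  unfold scaledDensity; fun_prop

theorem lintegral_sq_localPosterior {ρ : ℝ → ENNReal} (hρ : Measurable ρ) {t θ w : ℝ}
    (h0 : evidence ρ t (θ + t * w) ≠ 0) (h1 : evidence ρ t (θ + t * w) ≠ ⊤) :
    ∫⁻ h, ENNReal.ofReal (h ^ 2) ∂localPosterior ρ t (θ + t * w)
      = (∫⁻ h, ENNReal.ofReal (h ^ 2) * ρ (θ + t * (w + h)) ∂gaussianReal 0 1)
        / (∫⁻ h, ρ (θ + t * (w + h)) ∂gaussianReal 0 1) := by
  have hm : Measurable (localDensity ρ t (θ + t * w)) :=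
    (measurable_localDensity hρ t).of_uncurry_left
  rw [localPosterior_apply hρ, lintegral_withDensity_eq_lintegral_mul _ hm (by fun_prop),
    div_eq_mul_inv, ← lintegral_mul_const _ (by fun_prop)]
  refine lintegral_congr fun h => ?_
  rw [Pi.mul_apply, localDensity_of_ne h0 h1, div_eq_mul_inv, evidence]
  simp_rw [mul_add, add_assoc]
  ring

variable {φ : ℝ → ℝ} {c C τ σ M : ℝ}

theorem scaledDensity_le (hσ : 0 < σ) (hφ : ∀ x, φ x ≤ C) (x : ℝ) :
    scaledDensity φ σ x ≤ ENNReal.ofReal (σ⁻¹ * C) :=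
  ENNReal.ofReal_le_ofReal (mul_le_mul_of_nonneg_left (hφ _) (inv_nonneg.2 hσ.le))

/-- Since `|θ| / σ ≤ M < τ`, a margin `τ - M` remains inside the interval where `φ ≥ c`. Measured in
units of the noise level it is `(τ - M) * σ / t`. -/
theorem le_scaledDensity (hσ : 0 < σ) (hφ : ∀ x ∈ Ioo (-τ) τ, c ≤ φ x) {θ t v : ℝ} (ht : 0 < t)
    (hθ : |θ| / σ ≤ M) (hv : |v| < (τ - M) * σ / t) :
    ENNReal.ofReal (σ⁻¹ * c) ≤ scaledDensity φ σ (θ + t * v) := by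
  refine ENNReal.ofReal_le_ofReal (mul_le_mul_of_nonneg_left (hφ _ ?_) (inv_nonneg.2 hσ.le))
  rw [mem_Ioo, ← abs_lt, abs_div, abs_of_pos hσ, div_lt_iff₀ hσ]
  rw [div_le_iff₀ hσ] at hθ
  rw [lt_div_iff₀ ht] at hv
  calc |θ + t * v| ≤ |θ| + |v| * t := by
        refine (abs_add_le _ _).trans ?_
        rw [abs_mul, abs_of_pos ht, mul_comm]
    _ < τ * σ := by linarith

/-- Substitute `y = (θ + t v) / σ`, so that `v = (σ / t) (y - θ / σ)`, and use `(y - θ / σ)² ≤ 2 y²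
+ 2 M²`. -/
theorem lintegral_sq_mul_scaledDensity_le (hφm : Measurable φ) (hφ0 : ∀ x, 0 ≤ φ x)
    (hφ1 : ∫⁻ x, ENNReal.ofReal (φ x) = 1) (hσ : 0 < σ) {θ t : ℝ} (ht : 0 < t)
    (hθ : |θ| / σ ≤ M) :
    ∫⁻ v, ENNReal.ofReal (v ^ 2) * scaledDensity φ σ (θ + t * v)
      ≤ ENNReal.ofReal (σ ^ 2 / t ^ 3) * (2 * (∫⁻ y, ENNReal.ofReal (y ^ 2 * φ y)) +
        ENNReal.ofReal (2 * M ^ 2)) := by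
  have hv : ∀ v : ℝ, ENNReal.ofReal (v ^ 2) * scaledDensity φ σ (θ + t * v)
      ≤ ENNReal.ofReal (σ / t ^ 2) * (fun y => 2 * ENNReal.ofReal (y ^ 2 * φ y)
        + ENNReal.ofReal (2 * M ^ 2) * ENNReal.ofReal (φ y)) (θ / σ + t / σ * v) := by
    intro v
    set y := θ / σ + t / σ * v with hy
    have hy' : (θ + t * v) / σ = y := by rw [hy]; ring
    have hM : (θ / σ) ^ 2 ≤ M ^ 2 := by
      rw [sq_le_sq, abs_div, abs_of_pos hσ]
      exact hθ.trans (le_abs_self M)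
    simp only [scaledDensity, hy']
    rw [← ENNReal.ofReal_mul (sq_nonneg v), ← ENNReal.ofReal_mul (by positivity),
      ← ENNReal.ofReal_ofNat 2, ← ENNReal.ofReal_mul (by norm_num),
      ← ENNReal.ofReal_add (mul_nonneg (by norm_num) (mul_nonneg (sq_nonneg _) (hφ0 y)))
        (mul_nonneg (by positivity) (hφ0 y)), ← ENNReal.ofReal_mul (by positivity)]
    refine ENNReal.ofReal_le_ofReal ?_
    have hvy : v = σ / t * (y - θ / σ) := by
      rw [hy]; field_simp; ring
    have h2 : (y - θ / σ) ^ 2 ≤ 2 * y ^ 2 + 2 * M ^ 2 := by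
      nlinarith [sq_nonneg (y + θ / σ)]
    calc v ^ 2 * (σ⁻¹ * φ y) = σ / t ^ 2 * ((y - θ / σ) ^ 2 * φ y) := by
          rw [hvy]; field_simp
      _ ≤ σ / t ^ 2 * ((2 * y ^ 2 + 2 * M ^ 2) * φ y) := by
          have := hφ0 y
          gcongr
      _ = _ := by ring
  refine (lintegral_mono hv).trans ?_
  rw [lintegral_const_mul _ (by fun_prop)]
  set G : ℝ → ENNReal := fun y => 2 * ENNReal.ofReal (y ^ 2 * φ y)
        + ENNReal.ofReal (2 * M ^ 2) * ENNReal.ofReal (φ y) with hG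
  have hGm : Measurable G := by fun_prop
  have hcv : ∫⁻ v, G (θ / σ + t / σ * v) = ENNReal.ofReal (σ / t) * ∫⁻ y, G y := by
    have h1 : ∫⁻ v, (fun v => G (θ / σ + v)) (t / σ * v)
        = ENNReal.ofReal (σ / t) * ∫⁻ v, G (θ / σ + v) := by
      rw [← lintegral_map (f := fun v => G (θ / σ + v)) (by fun_prop) (measurable_const_mul (t / σ)),
        Real.map_volume_mul_left (by positivity), lintegral_smul_measure, inv_div,
        abs_of_pos (by positivity), smul_eq_mul]
    rw [h1, lintegral_add_left_eq_self G]
  rw [hcv, ← mul_assoc, ← ENNReal.ofReal_mul (by positivity), hG,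
    lintegral_add_left (by fun_prop), lintegral_const_mul _ (by fun_prop),
    lintegral_const_mul _ (by fun_prop), hφ1, mul_one]
  gcongr
  refine le_of_eq ?_
  field_simp

/-- The second moments of the local posteriors are bounded in expectation, uniformly in the
scales. -/
theorem exists_lintegral_sq_localPosterior_le (hφm : Measurable φ) (hφ0 : ∀ x, 0 ≤ φ x)
    (hφ1 : ∫⁻ x, ENNReal.ofReal (φ x) = 1) (hτ : M < τ) (hc : 0 < c)
    (hφ_le : ∀ x, φ x ≤ C) (hφ_ge : ∀ x ∈ Ioo (-τ) τ, c ≤ φ x) (hcC : c ≤ C)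
    (hφ_moment : Integrable fun x => x ^ 2 * φ x) :
    ∃ D : ENNReal, D < ⊤ ∧ ∀ σ θ t : ℝ, 0 < σ → 0 < t → |θ| / σ ≤ M →
      ∫⁻ w, ∫⁻ h, ENNReal.ofReal (h ^ 2) ∂localPosterior (scaledDensity φ σ) t (θ + t * w)
        ∂gaussianReal 0 1 ≤ D := by
  have hp : 0 < gaussianPDFReal 0 1 1 := gaussianPDFReal_pos _ _ _ one_ne_zero
  set m := 2 * (∫⁻ y, ENNReal.ofReal (y ^ 2 * φ y)) + ENNReal.ofReal (2 * M ^ 2) with hm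
  have hm_top : m < ⊤ := ENNReal.add_lt_top.2
    ⟨ENNReal.mul_lt_top (by norm_num) hφ_moment.lintegral_lt_top, ENNReal.ofReal_lt_top⟩
  have hκ : 0 < τ - M := sub_pos.2 hτ
  refine ⟨max (ENNReal.ofReal (C / c) * momentConst)
    (2 + ENNReal.ofReal (4 / (c * (τ - M) ^ 3 * gaussianPDFReal 0 1 1)) * m),
    max_lt (ENNReal.mul_lt_top ENNReal.ofReal_lt_top momentConst_lt_top)
      (ENNReal.add_lt_top.2 ⟨by norm_num, ENNReal.mul_lt_top ENNReal.ofReal_lt_top hm_top⟩),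
    fun σ θ t hσ ht hθ => ?_⟩
  set ρ := scaledDensity φ σ with hρ
  have hρm : Measurable ρ := measurable_scaledDensity hφm σ
  set ψ : ℝ → ENNReal := fun v => ρ (θ + t * v) with hψ
  have hψm : Measurable ψ := by fun_prop
  have hc' : 0 < σ⁻¹ * c := by positivity
  set r₀ := (τ - M) * σ / t with hr₀
  have hr₀pos : 0 < r₀ := by positivity
  have hge : ∀ r ≤ r₀, ∀ v ∈ Ioo (-r) r, ENNReal.ofReal (σ⁻¹ * c) ≤ ψ v := fun r hr v hv =>
    le_scaledDensity hσ hφ_ge ht hθ ((abs_lt.2 hv).trans_le hr)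
  have hle : ∀ v, ψ v ≤ ENNReal.ofReal (σ⁻¹ * C) := fun v => scaledDensity_le hσ hφ_le _
  have hZ : ∀ w, evidence ρ t (θ + t * w) = ∫⁻ h, ψ (w + h) ∂gaussianReal 0 1 := fun w => by
    simp only [evidence, hψ, mul_add, add_assoc]
  have hZ0 : ∀ w, evidence ρ t (θ + t * w) ≠ 0 := fun w => by
    rw [hZ]
    refine (lt_of_lt_of_le ?_ (lintegral_shift_ge hψm hc' (r := min r₀ 1) (lt_min hr₀pos one_pos)
      (min_le_right _ _) (hge _ (min_le_left _ _)) w)).ne'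
    have : 0 < min r₀ 1 := lt_min hr₀pos one_pos
    rw [ENNReal.ofReal_pos]
    positivity
  have hZ1 : ∀ w, evidence ρ t (θ + t * w) ≠ ⊤ := fun w => by
    rw [hZ]
    refine ((lintegral_mono fun h => hle (w + h)).trans_lt ?_).ne
    rw [lintegral_const, measure_univ, mul_one]
    exact ENNReal.ofReal_lt_top
  simp_rw [lintegral_sq_localPosterior hρm (hZ0 _) (hZ1 _)]
  -- The two regimes: `r₀` is the half-width, in noise units, of the interval on which the prior
  -- density is bounded below.
  rcases le_or_gt 1 r₀ with h1 | h1
  · refine le_trans ?_ (le_max_left _ _)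
    refine (lintegral_moment_ratio_le_of_bounded hψm hc' (mul_nonneg (inv_nonneg.2 hσ.le)
      (hc.le.trans hcC)) (hge 1 h1) hle).trans (le_of_eq ?_)
    congr 2
    field_simp
  · refine le_trans ?_ (le_max_right _ _)
    refine (lintegral_moment_ratio_le_of_moment hψm hc' hr₀pos h1.le (hge r₀ le_rfl)).trans ?_
    refine add_le_add_right ?_ _
    refine (mul_le_mul_right
      (lintegral_sq_mul_scaledDensity_le hφm hφ0 hφ1 hσ ht hθ) _).trans ?_
    rw [← mul_assoc, ← ENNReal.ofReal_mul (by positivity)]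
    refine mul_le_mul_left (ENNReal.ofReal_le_ofReal ?_) _
    -- In this regime the bound is proportional to `(σ / t) ^ 2`, and `r₀ < 1` bounds `σ / t`; hence
    -- uniformity over all small scales.
    have h2 : σ / t ≤ 1 / (τ - M) := by
      rw [le_div_iff₀ hκ]
      calc σ / t * (τ - M) = r₀ := by rw [hr₀]; ring
        _ ≤ 1 := h1.le
    calc 4 / (σ⁻¹ * c * r₀ * gaussianPDFReal 0 1 1) * (σ ^ 2 / t ^ 3)
        = 4 / (c * (τ - M) * gaussianPDFReal 0 1 1) * (σ / t) ^ 2 := by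
          rw [hr₀]; field_simp
      _ ≤ 4 / (c * (τ - M) * gaussianPDFReal 0 1 1) * (1 / (τ - M)) ^ 2 := by gcongr
      _ = 4 / (c * (τ - M) ^ 3 * gaussianPDFReal 0 1 1) := by field_simp

/-- Convergence of the normalising constants as the scale tends to `0`. -/
theorem tendsto_evidence {ρ : ℝ → ENNReal} (hρm : Measurable ρ) {K : ENNReal} (hK : K ≠ ⊤)
    (hρK : ∀ x, ρ x ≤ K) {θ : ℝ} (hρ : ContinuousAt ρ θ) {t : ℕ → ℝ}
    (ht : Tendsto t atTop (𝓝 0)) (w : ℝ) :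
    Tendsto (fun n => evidence ρ (t n) (θ + t n * w)) atTop (𝓝 (ρ θ)) := by
  have hlim : ∀ h : ℝ, Tendsto (fun n => ρ (θ + t n * w + t n * h)) atTop (𝓝 (ρ θ)) := by
    intro h
    refine hρ.tendsto.comp ?_
    simpa using ((tendsto_const_nhds (x := θ)).add (ht.mul_const w)).add (ht.mul_const h)
  have := tendsto_lintegral_of_dominated_convergence (μ := gaussianReal 0 1) (fun _ => K)
    (F := fun n h => ρ (θ + t n * w + t n * h)) (f := fun _ => ρ θ)
    (fun n => by fun_prop) (fun n => ae_of_all _ fun h => hρK _) (by simpa using hK)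
    (ae_of_all _ hlim)
  simpa [evidence] using this

/-- Convergence of the local posterior densities, which are eventually uniformly bounded. -/
theorem tendsto_localDensity {ρ : ℝ → ENNReal} (hρm : Measurable ρ) {K : ENNReal} (hK : K ≠ ⊤)
    (hρK : ∀ x, ρ x ≤ K) {θ : ℝ} (hρ : ContinuousAt ρ θ) (hρ0 : ρ θ ≠ 0) {t : ℕ → ℝ}
    (ht : Tendsto t atTop (𝓝 0)) (w : ℝ) :
    (∀ h, Tendsto (fun n => localDensity ρ (t n) (θ + t n * w) h) atTop (𝓝 1)) ∧
      ∃ b : ENNReal, b ≠ ⊤ ∧ ∀ᶠ n in atTop, ∀ h, localDensity ρ (t n) (θ + t n * w) h ≤ b := by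
  have hρt : ρ θ ≠ ⊤ := ((hρK θ).trans_lt hK.lt_top).ne
  have hZ := tendsto_evidence hρm hK hρK hρ ht w
  -- Eventually the evidence exceeds half its positive limit, so the densities are bounded by `K /
  -- (ρ θ / 2)`, uniformly in `h`.
  have hhalf : ρ θ / 2 < ρ θ := ENNReal.half_lt_self hρ0 hρt
  have hhalf0 : ρ θ / 2 ≠ 0 := (ENNReal.half_pos hρ0).ne'
  have hev : ∀ᶠ n in atTop, ρ θ / 2 < evidence ρ (t n) (θ + t n * w) ∧
      evidence ρ (t n) (θ + t n * w) < ⊤ :=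
    (hZ.eventually (lt_mem_nhds hhalf)).and (hZ.eventually (gt_mem_nhds hρt.lt_top))
  refine ⟨fun h => ?_, K / (ρ θ / 2), (ENNReal.div_lt_top hK hhalf0).ne, ?_⟩
  · have hlim : Tendsto (fun n => ρ (θ + t n * w + t n * h)) atTop (𝓝 (ρ θ)) := by
      refine hρ.tendsto.comp ?_
      simpa using ((tendsto_const_nhds (x := θ)).add (ht.mul_const w)).add (ht.mul_const h)
    have := ENNReal.Tendsto.div hlim (Or.inl hρ0) hZ (Or.inl hρt)
    rw [ENNReal.div_self hρ0 hρt] at this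
    refine this.congr' ?_
    filter_upwards [hev] with n hn
    exact (localDensity_of_ne (zero_le.trans_lt hn.1).ne' hn.2.ne h).symm
  · filter_upwards [hev] with n hn h
    rw [localDensity_of_ne (zero_le.trans_lt hn.1).ne' hn.2.ne]
    exact ENNReal.div_le_div (hρK _) hn.1.le

theorem continuousAt_scaledDensity {θ : ℝ} (hφ : ContinuousAt φ (θ / σ)) :
    ContinuousAt (scaledDensity φ σ) θ := by
  unfold scaledDensity
  refine ENNReal.continuous_ofReal.continuousAt.comp (continuousAt_const.mul ?_)
  exact ContinuousAt.comp (f := fun x => x / σ) hφ (continuousAt_id.div_const σ)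

end

end WhiteNoise

/-! ### Summability of the weights and almost sure square-summability -/

namespace WhiteNoise

/-- Cauchy condensation reduces the series to `∑ n ^ (-p)`. The maximum with `2` keeps the logarithm
positive. -/
theorem summable_one_div_mul_log_rpow {p : ℝ} (hp : 1 < p) :
    Summable fun n : ℕ => (max 2 (n : ℝ))⁻¹ / Real.log (max 2 (n : ℝ)) ^ p := by
  have hlog : ∀ n : ℕ, 0 < Real.log (max 2 (n : ℝ)) := fun n =>
    Real.log_pos (by linarith [le_max_left 2 (n : ℝ)])
  have hlog2 : 0 < Real.log 2 := Real.log_pos (by norm_num)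
  rw [← summable_condensed_iff_of_nonneg]
  -- The index is shifted because at `2 ^ 0 = 1` the maximum with `2` is active.
  · rw [← summable_nat_add_iff 1]
    have hs : Summable fun n : ℕ => (Real.log 2 ^ p)⁻¹ * (1 / ((n + 1 : ℕ) : ℝ) ^ p) :=
      (((summable_nat_add_iff 1).2 (Real.summable_one_div_nat_rpow.2 hp))).mul_left _
    refine hs.congr fun n => ?_
    have h2 : max 2 (((2 ^ (n + 1) : ℕ)) : ℝ) = 2 ^ (n + 1) := by
      push_cast
      refine max_eq_right ?_
      calc (2 : ℝ) = 2 ^ 1 := by norm_num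
        _ ≤ 2 ^ (n + 1) := pow_le_pow_right₀ (by norm_num) (by omega)
    rw [h2, Real.log_pow, Real.mul_rpow (by positivity) hlog2.le]
    field_simp
  · intro n
    have := hlog n
    positivity
  · intro m n _ hmn
    have h1 : max 2 (m : ℝ) ≤ max 2 (n : ℝ) := max_le_max_left _ (by exact_mod_cast hmn)
    have h2 := hlog m
    have h3 : (0 : ℝ) < max 2 (m : ℝ) := by positivity
    gcongr

namespace RegularBasis

variable {S : ℕ} (B : RegularBasis S)

/-- The role of `δ > 1/2`. With one function per level the weights are `1 / (a (log a) ^ (2δ))` with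
`a = max 2 |l|`. In the other case the `2 ^ l` functions of level `l` cancel the factor `2 ^ (-l)`
and leave a multiple of `l ^ (-2δ)`. -/
theorem summable_weight {δ : ℝ} (hδ : 1 / 2 < δ) : Summable (B.weight (-1 / 2) δ) := by
  have hp : 1 < 2 * δ := by linarith
  have hw : ∀ i, B.weight (-1 / 2) δ i = (B.a i.1)⁻¹ / Real.log (B.a i.1) ^ (2 * δ) := fun i => by
    rw [weight, show (2 : ℝ) * (-1 / 2) = -1 by norm_num, Real.rpow_neg_one]
  rcases B.type with h | h
  · have hZ : Summable fun l : ℤ => (max 2 (|l| : ℝ))⁻¹ / Real.log (max 2 (|l| : ℝ)) ^ (2 * δ) := by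
      refine Summable.of_nat_of_neg ?_ ?_
      · simpa using summable_one_div_mul_log_rpow hp
      · simpa using summable_one_div_mul_log_rpow hp
    have hinj : Function.Injective fun i : B.Index => (i.1 : ℤ) := by
      rintro ⟨l, k⟩ ⟨l', k'⟩ hll
      obtain rfl : l = l' := Subtype.ext hll
      obtain ⟨z, hz⟩ := Finset.card_eq_one.1 (h l l.2).1
      have hk : ∀ k : B.Z l, (k : ℤ) = z := fun k =>
        Finset.mem_singleton.1 (hz.le k.2)
      rw [show k = k' from Subtype.ext ((hk k).trans (hk k').symm)]
    refine (hZ.comp_injective hinj).congr fun i => ?_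
    rw [hw, (h i.1 i.1.2).2]
    simp
  · have hlog2 : 0 < Real.log 2 := Real.log_pos (by norm_num)
    rw [summable_sigma_of_nonneg fun i => (B.weight_pos _ _ i).le]
    refine ⟨fun l => Summable.of_finite, ?_⟩
    have hN : Summable fun n : ℕ => (Real.log 2 ^ (2 * δ))⁻¹ * (1 / (n : ℝ) ^ (2 * δ)) :=
      (Real.summable_one_div_nat_rpow.2 hp).mul_left _
    have hinj : Function.Injective fun l : B.𝓛 => (l : ℤ).toNat := by
      intro l l' hll
      have h1 := (h l l.2).1
      have h2 := (h l' l'.2).1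
      refine Subtype.ext ?_
      simp only at hll
      omega
    refine (hN.comp_injective hinj).congr fun l => ?_
    obtain ⟨h1, h2, h3⟩ := h l l.2
    obtain ⟨m, hm⟩ : ∃ m : ℕ, (l : ℤ) = m := ⟨(l : ℤ).toNat, by omega⟩
    simp_rw [hw]
    rw [tsum_fintype, Finset.sum_const, Finset.card_univ, Fintype.card_coe, h2, h3, hm,
      Function.comp_apply, hm]
    simp only [Int.toNat_natCast, zpow_natCast, nsmul_eq_mul, Nat.cast_pow, Nat.cast_ofNat]
    rw [Real.log_pow, Real.mul_rpow (by positivity) hlog2.le]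
    field_simp

theorem measurable_val (s δ : ℝ) :
    Measurable (LogSobolev.val : B.LogSobolev s δ → B.Index → ℝ) := by
  refine measurable_pi_lambda _ fun i => ?_
  have hw : 0 < √(B.weight s δ i) := Real.sqrt_pos.2 (B.weight_pos s δ i)
  have h : ∀ f : B.LogSobolev s δ,
      f.val i = (√(B.weight s δ i))⁻¹ * (B.toEll2 s δ f : B.Index → ℝ) i := fun f => by
    have : (B.toEll2 s δ f : B.Index → ℝ) i = √(B.weight s δ i) * f.val i := rfl
    rw [this, inv_mul_cancel_left₀ hw.ne']
  simp_rw [h]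
  refine Continuous.measurable ?_
  refine continuous_const.mul ?_
  have hc : Continuous fun x : lp (fun _ : B.Index => ℝ) 2 => (x : B.Index → ℝ) i :=
    (continuous_apply i).comp (lp.uniformContinuous_coe (E := fun _ : B.Index => ℝ)).continuous
  exact hc.comp (B.isometry_toEll2 s δ).continuous

variable {B} in
theorem LogSobolev.val_injective {s δ : ℝ} :
    Function.Injective (LogSobolev.val : B.LogSobolev s δ → B.Index → ℝ) :=
  Subtype.val_injective

variable {B} in
theorem LogSobolev.val_add {s δ : ℝ} (f g : B.LogSobolev s δ) : (f + g).val = f.val + g.val := rfl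

variable {B} in
theorem LogSobolev.val_sub {s δ : ℝ} (f g : B.LogSobolev s δ) : (f - g).val = f.val - g.val := rfl

variable {B} in
theorem LogSobolev.val_smul {s δ : ℝ} (t : ℝ) (f : B.LogSobolev s δ) :
    (t • f).val = t • f.val := rfl

variable {B} in
theorem LogSobolev.summable_val {s δ : ℝ} (f : B.LogSobolev s δ) :
    Summable fun i => B.weight s δ i * f.val i ^ 2 := f.2

theorem ofSeq_val_self {s δ : ℝ} (f : B.LogSobolev s δ) : B.ofSeq s δ f.val = f :=
  LogSobolev.val_injective (B.ofSeq_val f.summable_val)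

theorem coeff_synthesis {c : B.Index → ℝ} (hc : Summable fun i => c i ^ 2) :
    B.coeff (B.synthesis c) = c := by
  funext i
  rw [coeff, ← B.ψ.repr_apply_apply, synthesis, LinearIsometryEquiv.apply_symm_apply, seqToEll2,
    dif_pos ((memℓp_two_iff c).2 hc)]

theorem summable_coeff_sq (f : L2) : Summable fun i => B.coeff f i ^ 2 := by
  refine ((memℓp_two_iff _).1 (B.ψ.repr f).2).congr fun i => ?_
  rw [coeff, B.ψ.repr_apply_apply]

theorem incl_synthesis_val {δ : ℝ} (hδ : 0 ≤ δ) {c : B.Index → ℝ}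
    (hc : Summable fun i => c i ^ 2) : (B.incl δ (B.synthesis c)).val = c := by
  rw [B.incl_val hδ, B.coeff_synthesis hc]

end RegularBasis

/-- If the weighted second moments of the coordinates are summable, so are almost surely the
weighted squares. -/
theorem ae_summable_infinitePi {ι : Type*} [Countable ι] (q : ι → Measure ℝ)
    [∀ i, IsProbabilityMeasure (q i)] {a : ι → ℝ} (ha : ∀ i, 0 ≤ a i)
    (h : ∑' i, ENNReal.ofReal (a i) * ∫⁻ y, ENNReal.ofReal (y ^ 2) ∂q i ≠ ⊤) :
    ∀ᵐ x ∂Measure.infinitePi q, Summable fun i => a i * x i ^ 2 := by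
  have hint : ∫⁻ x, ∑' i, ENNReal.ofReal (a i * x i ^ 2) ∂Measure.infinitePi q ≠ ⊤ := by
    rw [lintegral_tsum fun i => Measurable.aemeasurable (by fun_prop)]
    refine ne_of_eq_of_ne (tsum_congr fun i => ?_) h
    simp_rw [ENNReal.ofReal_mul (ha i)]
    rw [lintegral_const_mul _ (by fun_prop)]
    congr 1
    exact (measurePreserving_eval_infinitePi q i).lintegral_comp
      (f := fun y => ENNReal.ofReal (y ^ 2)) (by fun_prop)
  filter_upwards [ae_lt_top (by fun_prop) hint] with x hx
  exact (ENNReal.summable_toReal hx.ne).congr fun i =>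
    ENNReal.toReal_ofReal (mul_nonneg (ha i) (sq_nonneg _))

namespace ScaledDensities

variable {S : ℕ} {B : RegularBasis S} (Q : ScaledDensities B)

/-- The density of `π_{lk}`. -/
noncomputable def density (i : B.Index) : ℝ → ENNReal := scaledDensity Q.φ (Q.σ i.1)

theorem coordLaw_eq (i : B.Index) : Q.coordLaw i = volume.withDensity (Q.density i) := rfl

theorem measurable_density (i : B.Index) : Measurable (Q.density i) :=
  measurable_scaledDensity Q.measurable_φ _

instance (i : B.Index) : IsProbabilityMeasure (volume.withDensity (Q.density i)) :=
  inferInstanceAs (IsProbabilityMeasure (Q.coordLaw i))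

instance (i : B.Index) (t : ℝ) : IsMarkovKernel (localPosterior (Q.density i) t) :=
  isMarkovKernel_localPosterior (Q.measurable_density i) t

instance (i : B.Index) (t : ℝ) :
    IsProbabilityMeasure (volume.withDensity (evidence (Q.density i) t)) :=
  isProbabilityMeasure_evidence (Q.measurable_density i) t

/-- The second moment of a coordinate is at most a constant times `σ ^ 2`, and these are summable.
Hence `synthesis` almost surely does not take its default value under the prior. -/
theorem ae_summable_sq (hφ : Integrable fun x => x ^ 2 * Q.φ x) :
    ∀ᵐ θ ∂Measure.infinitePi Q.coordLaw, Summable fun i => θ i ^ 2 := by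
  set m := 2 * (∫⁻ y, ENNReal.ofReal (y ^ 2 * Q.φ y)) with hm
  have hm_top : m ≠ ⊤ := (ENNReal.mul_lt_top (by norm_num) hφ.lintegral_lt_top).ne
  have hmom : ∀ i, ∫⁻ y, ENNReal.ofReal (y ^ 2) ∂Q.coordLaw i
      ≤ ENNReal.ofReal (Q.σ i.1 ^ 2) * m := by
    intro i
    rw [coordLaw_eq, lintegral_withDensity_eq_lintegral_mul _ (Q.measurable_density i)
      (by fun_prop)]
    have := lintegral_sq_mul_scaledDensity_le Q.measurable_φ Q.φ_nonneg Q.lintegral_φ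
      (Q.σ_pos _ i.1.2) (θ := 0) (t := 1) (M := 0) one_pos (by simp)
    simp only [zero_add, one_mul, one_pow, div_one, ne_eq, OfNat.ofNat_ne_zero,
      not_false_eq_true, zero_pow, mul_zero, ENNReal.ofReal_zero, add_zero] at this
    simpa only [Pi.mul_apply, mul_comm, density] using this
  have h := ae_summable_infinitePi Q.coordLaw (a := fun _ => 1) (fun _ => zero_le_one) ?_
  · simpa using h
  · simp only [ENNReal.ofReal_one, one_mul]
    refine ((ENNReal.tsum_le_tsum hmom).trans_lt ?_).ne
    rw [ENNReal.tsum_mul_right]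
    exact ENNReal.mul_lt_top (lt_top_iff_ne_top.2 Q.summable_σ.tsum_ofReal_ne_top)
      (lt_top_iff_ne_top.2 hm_top)

end ScaledDensities

/-- White noise lies in `H(δ)`: its expected squared norm is the sum of the weights. -/
theorem RegularBasis.ae_summable_gaussian {S : ℕ} (B : RegularBasis S) {δ : ℝ} (hδ : 1 / 2 < δ) :
    ∀ᵐ w ∂Measure.infinitePi (fun _ : B.Index => gaussianReal 0 1),
      Summable fun i => B.weight (-1 / 2) δ i * w i ^ 2 := by
  refine ae_summable_infinitePi _ (fun i => (B.weight_pos _ _ i).le) ?_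
  simp_rw [lintegral_sq_gaussianReal, mul_one]
  exact (B.summable_weight hδ).tsum_ofReal_ne_top

end WhiteNoise

/-! ### The posterior as a product of one-dimensional posteriors -/

namespace WhiteNoise

/-- The law of a sequence of independent standard normal variables. -/
noncomputable abbrev gaussianSeq (ι : Type*) : Measure (ι → ℝ) :=
  Measure.infinitePi fun _ => gaussianReal 0 1

theorem map_add_gaussianSeq {ι : Type*} (g : ι → ℝ) :
    (gaussianSeq ι).map (fun w => w + g) = Measure.infinitePi fun i => gaussianReal (g i) 1 := by
  have h := Measure.infinitePi_map_pi (fun _ : ι => gaussianReal 0 1)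
    (f := fun i x => x + g i) (fun i => measurable_add_const (g i))
  simpa [gaussianReal_map_add_const, Pi.add_def] using h

namespace ScaledDensities

variable {S : ℕ} {B : RegularBasis S} (Q : ScaledDensities B)

/-- The law of the coefficients of the data when the parameter is drawn from the prior. -/
noncomputable def marginalSeq (t : ℝ) : Measure (B.Index → ℝ) :=
  Measure.infinitePi fun i => volume.withDensity (evidence (Q.density i) t)

/-- The posterior law of the rescaled coefficients `(θ - x) / t`, given the data `x = θ + t w`. -/
noncomputable def posteriorSeq (t : ℝ) : Kernel (B.Index → ℝ) (B.Index → ℝ) :=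
  Measure.kernelInfinitePi fun i => localPosterior (Q.density i) t

instance (t : ℝ) : IsProbabilityMeasure (Q.marginalSeq t) := by
  unfold marginalSeq; infer_instance

instance (t : ℝ) : IsMarkovKernel (Q.posteriorSeq t) := by
  unfold posteriorSeq; infer_instance

/-- Bayes formula for the coefficients. -/
theorem map_prod_gaussianSeq_eq_compProd (t : ℝ) :
    ((Measure.infinitePi Q.coordLaw).prod (gaussianSeq B.Index)).map
        (fun p => (p.1 + t • p.2, -p.2))
      = Q.marginalSeq t ⊗ₘ Q.posteriorSeq t := by
  -- Read as laws of sequences of pairs, both sides are product measures, so the identity reduces to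
  -- the one-dimensional Bayes formula.
  let zip : (B.Index → ℝ) × (B.Index → ℝ) → B.Index → ℝ × ℝ := fun p i => (p.1 i, p.2 i)
  let unzip : (B.Index → ℝ × ℝ) → (B.Index → ℝ) × (B.Index → ℝ) :=
    fun z => (fun i => (z i).1, fun i => (z i).2)
  have hzip : Measurable zip := by fun_prop
  have hunzip : Measurable unzip := by fun_prop
  have hT : Measurable fun p : (B.Index → ℝ) × (B.Index → ℝ) => (p.1 + t • p.2, -p.2) := by
    fun_prop
  have key : (((Measure.infinitePi Q.coordLaw).prod (gaussianSeq B.Index)).map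
      (fun p => (p.1 + t • p.2, -p.2))).map zip
      = (Q.marginalSeq t ⊗ₘ Q.posteriorSeq t).map zip := by
    have h1 := Measure.map_infinitePi_prod_infinitePi Q.coordLaw
      (fun _ : B.Index => gaussianReal 0 1)
    have h2 := congrArg (Measure.map fun (z : B.Index → ℝ × ℝ) i =>
      ((z i).1 + t * (z i).2, -(z i).2)) h1
    rw [Measure.map_map (by fun_prop) (by fun_prop),
      Measure.infinitePi_map_pi (fun i => (Q.coordLaw i).prod (gaussianReal 0 1))
        (f := fun _ z => (z.1 + t * z.2, -z.2)) (fun i => by fun_prop)] at h2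
    rw [Measure.map_map hzip hT]
    refine Eq.trans ?_ (h2.trans ?_)
    · rfl
    · rw [marginalSeq, posteriorSeq, Measure.map_infinitePi_compProd_kernelInfinitePi]
      congr 1
      funext i
      exact map_prod_gaussianReal_eq_compProd (Q.measurable_density i) t
  have h3 := congrArg (Measure.map unzip) key
  rw [Measure.map_map hunzip hzip, Measure.map_map hunzip hzip] at h3
  have hid : unzip ∘ zip = id := rfl
  rwa [hid, Measure.map_id, Measure.map_id] at h3

theorem map_prod_gaussianSeq_eq_marginalSeq (t : ℝ) :
    ((Measure.infinitePi Q.coordLaw).prod (gaussianSeq B.Index)).map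
        (fun p => p.1 + t • p.2) = Q.marginalSeq t := by
  have h := congrArg Measure.fst (Q.map_prod_gaussianSeq_eq_compProd t)
  rwa [Measure.fst_compProd, Measure.fst, Measure.map_map measurable_fst (by fun_prop)] at h

/-- The law of the data under a fixed square-summable parameter is absolutely continuous with
respect to the marginal law. -/
theorem map_gaussianSeq_absolutelyContinuous (hφ : Integrable fun x => x ^ 2 * Q.φ x) {t : ℝ}
    (ht : t ≠ 0) {θ₀ : B.Index → ℝ} (hθ₀ : Summable fun i => θ₀ i ^ 2) :
    (gaussianSeq B.Index).map (fun w => θ₀ + t • w) ≪ Q.marginalSeq t := by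
  refine Measure.AbsolutelyContinuous.mk fun A hA h0 => ?_
  have hT : Measurable fun p : (B.Index → ℝ) × (B.Index → ℝ) => p.1 + t • p.2 := by fun_prop
  rw [← map_prod_gaussianSeq_eq_marginalSeq, Measure.map_apply hT hA,
    Measure.measure_prod_null (hT hA)] at h0
  -- A null set of the marginal law is null under almost every prior draw. Fix one square-summable
  -- draw `θ`: in noise units, moving from `θ` to `θ₀` is the `ℓ²` shift `g`.
  obtain ⟨θ, hθ, hθs⟩ := (h0.and (Q.ae_summable_sq hφ)).exists
  set g : B.Index → ℝ := t⁻¹ • (θ₀ - θ) with hg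
  have hgs : Summable fun i => g i ^ 2 := by
    have hd : Summable fun i => (θ₀ i - θ i) ^ 2 := by
      refine Summable.of_nonneg_of_le (fun i => sq_nonneg _) (fun i => ?_)
        ((hθ₀.add hθs).mul_left 2)
      nlinarith [sq_nonneg (θ₀ i + θ i)]
    refine (hd.mul_left (t⁻¹ ^ 2)).congr fun i => ?_
    simp [hg, mul_pow]
  have hac := infinitePi_gaussianReal_absolutelyContinuous hgs
  rw [← map_add_gaussianSeq] at hac
  have h1 := hac hθ
  have hθm : MeasurableSet (Prod.mk θ ⁻¹' ((fun p : (B.Index → ℝ) × (B.Index → ℝ) =>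
    p.1 + t • p.2) ⁻¹' A)) := measurable_prodMk_left (hT hA)
  rw [Measure.map_apply (by fun_prop) hθm] at h1
  rw [Measure.map_apply (by fun_prop) hA]
  convert h1 using 2
  ext w
  simp only [mem_preimage, hg, smul_add, smul_inv_smul₀ ht]
  rw [show θ + (t • w + (θ₀ - θ)) = θ₀ + t • w by abel]

variable {δ : ℝ}

/-- The posterior on `L²`, as a function of the coefficients of the data. -/
noncomputable def posteriorL2 (δ t : ℝ) : Kernel (B.H δ) L2 :=
  (Kernel.id ×ₖ (Q.posteriorSeq t).comap RegularBasis.LogSobolev.val (B.measurable_val _ _)).map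
    fun p => B.synthesis (p.1.val + t • p.2)

theorem measurable_synthesis_val (δ t : ℝ) :
    Measurable fun p : B.H δ × (B.Index → ℝ) => B.synthesis (p.1.val + t • p.2) :=
  B.measurable_synthesis.comp
    (((B.measurable_val _ _).comp measurable_fst).add (measurable_snd.const_smul t))

instance (δ t : ℝ) : IsMarkovKernel (Q.posteriorL2 δ t) :=
  Kernel.IsMarkovKernel.map _ (measurable_synthesis_val δ t)

theorem posteriorL2_apply (δ t : ℝ) (x : B.H δ) :
    Q.posteriorL2 δ t x
      = (Q.posteriorSeq t x.val).map fun h => B.synthesis (x.val + t • h) := by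
  rw [posteriorL2, Kernel.map_apply _ (measurable_synthesis_val δ t), Kernel.prod_apply,
    Kernel.id_apply, Kernel.comap_apply, Measure.dirac_prod,
    Measure.map_map (measurable_synthesis_val δ t) (by fun_prop)]
  rfl

theorem measurable_ofSeq_synthesis (δ t : ℝ) :
    Measurable fun p : (B.Index → ℝ) × (B.Index → ℝ) =>
      (B.ofSeq (-1 / 2) δ p.1, B.synthesis (p.1 + t • p.2)) :=
  ((B.measurable_ofSeq _ _).comp measurable_fst).prodMk
    (B.measurable_synthesis.comp (measurable_fst.add (measurable_snd.const_smul t)))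

/-- Almost surely neither `synthesis` nor `ofSeq` takes its default value, so the data in `H(δ)`
have the coefficients `θ + t w`. -/
theorem ae_data_val (hφ : Integrable fun x => x ^ 2 * Q.φ x) (hδ : 1 / 2 < δ) (t : ℝ) :
    ∀ᵐ p ∂(Measure.infinitePi Q.coordLaw).prod (gaussianSeq B.Index),
      (Summable fun i => p.1 i ^ 2) ∧
      (B.incl δ (B.synthesis p.1) + t • B.ofSeq (-1 / 2) δ p.2).val = p.1 + t • p.2 := by
  have h1 := (Measure.quasiMeasurePreserving_fst (ν := gaussianSeq B.Index)).ae
    (Q.ae_summable_sq hφ)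
  have h2 := (Measure.quasiMeasurePreserving_snd (μ := Measure.infinitePi Q.coordLaw)).ae
    (B.ae_summable_gaussian hδ)
  filter_upwards [h1, h2] with p hp1 hp2
  refine ⟨hp1, ?_⟩
  rw [RegularBasis.LogSobolev.val_add, RegularBasis.LogSobolev.val_smul,
    B.incl_synthesis_val (by linarith) hp1, B.ofSeq_val hp2]

theorem ae_ofSeq_val_marginalSeq (hφ : Integrable fun x => x ^ 2 * Q.φ x) (hδ : 1 / 2 < δ)
    (t : ℝ) : ∀ᵐ x ∂Q.marginalSeq t, (B.ofSeq (-1 / 2) δ x).val = x := by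
  have hm : MeasurableSet {x | (B.ofSeq (-1 / 2) δ x).val = x} :=
    measurableSet_eq_fun ((B.measurable_val _ _).comp (B.measurable_ofSeq _ _)) measurable_id
  rw [← map_prod_gaussianSeq_eq_marginalSeq, ae_map_iff (by fun_prop) hm]
  filter_upwards [Q.ae_data_val hφ hδ t] with p hp
  rw [← hp.2, B.ofSeq_val_self]

/-- The joint law of the parameter and the data. -/
theorem map_swap_prior_compProd_experiment (hφ : Integrable fun x => x ^ 2 * Q.φ x)
    (hδ : 1 / 2 < δ) (n : ℕ) :
    (Q.prior ⊗ₘ B.experiment δ n).map Prod.swap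
      = (Q.marginalSeq (√(n : ℝ))⁻¹ ⊗ₘ Q.posteriorSeq (√(n : ℝ))⁻¹).map
        fun p => (B.ofSeq (-1 / 2) δ p.1, B.synthesis (p.1 + (√(n : ℝ))⁻¹ • p.2)) := by
  set t := (√(n : ℝ))⁻¹ with ht
  have hincl := B.measurable_incl δ
  have hsyn := B.measurable_synthesis
  have hof := B.measurable_ofSeq (-1 / 2) δ
  have hdata : Measurable fun p : (B.Index → ℝ) × (B.Index → ℝ) =>
      B.incl δ (B.synthesis p.1) + t • B.ofSeq (-1 / 2) δ p.2 :=
    (hincl.comp (hsyn.comp measurable_fst)).add ((hof.comp measurable_snd).const_smul t)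
  have hpair : Measurable fun p : (B.Index → ℝ) × (B.Index → ℝ) =>
      (B.synthesis p.1, B.incl δ (B.synthesis p.1) + t • B.ofSeq (-1 / 2) δ p.2) :=
    (hsyn.comp measurable_fst).prodMk hdata
  have hjoint : Q.prior ⊗ₘ B.experiment δ n
      = ((Measure.infinitePi Q.coordLaw).prod (gaussianSeq B.Index)).map
        fun p => (B.synthesis p.1, B.incl δ (B.synthesis p.1) + t • B.ofSeq (-1 / 2) δ p.2) := by
    ext A hA
    rw [Measure.compProd_apply hA, Measure.map_apply hpair hA, Measure.prod_apply (hpair hA),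
      prior, lintegral_map (Kernel.measurable_kernel_prodMk_left hA) hsyn]
    refine lintegral_congr fun θ => ?_
    have hAθ : MeasurableSet (Prod.mk (B.synthesis θ) ⁻¹' A) := measurable_prodMk_left hA
    change ((B.gaussian δ).map fun w => B.incl δ (B.synthesis θ) + t • w) _ = _
    have hadd : Measurable fun w : B.H δ => B.incl δ (B.synthesis θ) + t • w := by fun_prop
    rw [Measure.map_apply hadd hAθ, RegularBasis.gaussian, Measure.map_apply hof (hadd hAθ)]
    rfl
  have hG := measurable_ofSeq_synthesis (B := B) δ t
  rw [hjoint, ← map_prod_gaussianSeq_eq_compProd, Measure.map_map measurable_swap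
    hpair, Measure.map_map hG (by fun_prop)]
  -- Both maps give the data and the parameter: the parameter is recovered as `(θ + t w) + t (-w) =
  -- θ`.
  refine Measure.map_congr ?_
  filter_upwards [Q.ae_data_val hφ hδ t] with p hp
  simp only [Function.comp_apply, Prod.swap_prod_mk]
  rw [← hp.2, B.ofSeq_val_self, hp.2, smul_neg, add_neg_cancel_right]

theorem experiment_comp_prior (hφ : Integrable fun x => x ^ 2 * Q.φ x) (hδ : 1 / 2 < δ) (n : ℕ) :
    B.experiment δ n ∘ₘ Q.prior
      = (Q.marginalSeq (√(n : ℝ))⁻¹).map (B.ofSeq (-1 / 2) δ) := by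
  have hof := B.measurable_ofSeq (-1 / 2) δ
  have h := congrArg Measure.fst (Q.map_swap_prior_compProd_experiment hφ hδ n)
  rw [Measure.fst_map_swap, Measure.snd_compProd, Measure.fst,
    Measure.map_map measurable_fst (measurable_ofSeq_synthesis δ _)] at h
  rw [h]
  nth_rw 2 [← Measure.fst_compProd (Q.marginalSeq (√(n : ℝ))⁻¹) (Q.posteriorSeq (√(n : ℝ))⁻¹)]
  rw [Measure.fst, Measure.map_map hof measurable_fst]
  rfl

/-- The posterior is the product of the one-dimensional posteriors. -/
theorem posterior_ae_eq (hφ : Integrable fun x => x ^ 2 * Q.φ x) (hδ : 1 / 2 < δ) (n : ℕ) :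
    ∀ᵐ x ∂Q.marginalSeq (√(n : ℝ))⁻¹, B.posterior δ Q.prior n (B.ofSeq (-1 / 2) δ x)
      = (Q.posteriorSeq (√(n : ℝ))⁻¹ x).map fun h => B.synthesis (x + (√(n : ℝ))⁻¹ • h) := by
  set t := (√(n : ℝ))⁻¹ with ht
  have hsyn := B.measurable_synthesis
  have hof := B.measurable_ofSeq (-1 / 2) δ
  have hval := Q.ae_ofSeq_val_marginalSeq hφ hδ t
  have hG := measurable_ofSeq_synthesis (B := B) δ t
  -- A posterior is characterised almost everywhere by the joint law of data and parameter, so it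
  -- suffices that `posteriorL2` disintegrates this law.
  have hcomp : (B.experiment δ n ∘ₘ Q.prior) ⊗ₘ Q.posteriorL2 δ t
      = (Q.prior ⊗ₘ B.experiment δ n).map Prod.swap := by
    rw [Q.map_swap_prior_compProd_experiment hφ hδ n, Q.experiment_comp_prior hφ hδ n]
    ext A hA
    rw [Measure.compProd_apply hA, lintegral_map (Kernel.measurable_kernel_prodMk_left hA) hof,
      Measure.map_apply hG hA, Measure.compProd_apply (hG hA)]
    refine lintegral_congr_ae ?_
    filter_upwards [hval] with x hx
    have hs : Measurable fun h : B.Index → ℝ => B.synthesis (x + t • h) :=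
      hsyn.comp (by fun_prop)
    rw [posteriorL2_apply, hx, Measure.map_apply hs (measurable_prodMk_left hA)]
    rfl
  have hae := ae_eq_posterior_of_compProd_eq hcomp
  rw [Q.experiment_comp_prior hφ hδ n] at hae
  filter_upwards [ae_of_ae_map hof.aemeasurable hae, hval] with x hx hv
  rw [RegularBasis.posterior, ← hx, posteriorL2_apply, hv]

theorem rescaledPosterior_ae_eq_of_marginal (hφ : Integrable fun x => x ^ 2 * Q.φ x)
    (hδ : 1 / 2 < δ) {n : ℕ} (hn : n ≠ 0) :
    ∀ᵐ x ∂Q.marginalSeq (√(n : ℝ))⁻¹,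
      B.rescaledPosterior δ Q.prior n (B.ofSeq (-1 / 2) δ x)
        = (Q.posteriorSeq (√(n : ℝ))⁻¹ x).map (B.ofSeq (-1 / 2) δ) := by
  have hsn : √(n : ℝ) ≠ 0 := by positivity
  set t := (√(n : ℝ))⁻¹ with ht
  have hsyn := B.measurable_synthesis
  have hof := B.measurable_ofSeq (-1 / 2) δ
  have hincl := B.measurable_incl δ
  -- Posterior draws are square-summable because, by the Bayes formula, jointly with the data they
  -- are prior draws. Thus `synthesis` followed by `incl` preserves their coefficients.
  have hl2 : ∀ᵐ x ∂Q.marginalSeq t, ∀ᵐ h ∂Q.posteriorSeq t x,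
      Summable fun i => (x + t • h) i ^ 2 := by
    refine Measure.ae_ae_of_ae_compProd ?_
      (p := fun p : (B.Index → ℝ) × (B.Index → ℝ) => Summable fun i => (p.1 + t • p.2) i ^ 2)
    have hm : MeasurableSet {p : (B.Index → ℝ) × (B.Index → ℝ) |
        Summable fun i => (p.1 + t • p.2) i ^ 2} := by
      have h := RegularBasis.measurableSet_memℓp (ι := B.Index)
      simp_rw [RegularBasis.memℓp_two_iff] at h
      have hadd : Measurable fun p : (B.Index → ℝ) × (B.Index → ℝ) => p.1 + t • p.2 := by
        fun_prop
      exact hadd h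
    rw [← map_prod_gaussianSeq_eq_compProd, ae_map_iff (by fun_prop) hm]
    filter_upwards [Q.ae_data_val hφ hδ t] with p hp
    simpa using hp.1
  filter_upwards [Q.posterior_ae_eq hφ hδ n, hl2, Q.ae_ofSeq_val_marginalSeq hφ hδ t]
    with x hx hx2 hxv
  have hs : Measurable fun h : B.Index → ℝ => B.synthesis (x + t • h) := hsyn.comp (by fun_prop)
  rw [RegularBasis.rescaledPosterior, hx, Measure.map_map hincl hs,
    Measure.map_map (by fun_prop) (hincl.comp hs)]
  refine Measure.map_congr ?_
  filter_upwards [hx2] with h hh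
  simp only [Function.comp_apply]
  rw [← B.ofSeq_val_self (√(n : ℝ) • (B.incl δ (B.synthesis (x + t • h))
    - B.ofSeq (-1 / 2) δ x)), RegularBasis.LogSobolev.val_smul, RegularBasis.LogSobolev.val_sub,
    B.incl_synthesis_val (by linarith) hh, hxv, add_sub_cancel_left, ht, smul_inv_smul₀ hsn]

/-- The rescaled posterior is a product measure, almost surely under the true parameter. -/
theorem rescaledPosterior_ae_eq (hφ : Integrable fun x => x ^ 2 * Q.φ x) (hδ : 1 / 2 < δ)
    {n : ℕ} (hn : n ≠ 0) (f : L2) :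
    ∀ᵐ w ∂gaussianSeq B.Index,
      B.rescaledPosterior δ Q.prior n (B.incl δ f + (√(n : ℝ))⁻¹ • B.ofSeq (-1 / 2) δ w)
        = (Q.posteriorSeq (√(n : ℝ))⁻¹ (B.coeff f + (√(n : ℝ))⁻¹ • w)).map
          (B.ofSeq (-1 / 2) δ) := by
  have ht : (√(n : ℝ))⁻¹ ≠ 0 := by positivity
  -- This carries the almost sure identity from the marginal law of the data to their law under `f`.
  have hac := Q.map_gaussianSeq_absolutelyContinuous hφ ht (B.summable_coeff_sq f)
  have hm : AEMeasurable (fun w => B.coeff f + (√(n : ℝ))⁻¹ • w) (gaussianSeq B.Index) := by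
    fun_prop
  filter_upwards [ae_of_ae_map hm (hac.ae_le (Q.rescaledPosterior_ae_eq_of_marginal hφ hδ hn)),
    B.ae_summable_gaussian hδ] with w hw hws
  rw [← hw, ← B.ofSeq_val_self (B.incl δ f + (√(n : ℝ))⁻¹ • B.ofSeq (-1 / 2) δ w),
    RegularBasis.LogSobolev.val_add, RegularBasis.LogSobolev.val_smul,
    B.incl_val (by linarith), B.ofSeq_val hws]

end ScaledDensities

end WhiteNoise

/-! ### Bounded Lipschitz distance: finite-dimensional part and tail -/

namespace MeasureTheory

/-- The pushforward of a measure along a map with a measurable right inverse which is almost surely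
a left inverse is bounded by the measure of preimages, also on non-measurable sets. -/
theorem Measure.map_apply_le_of_rightInverse {α β : Type*} [MeasurableSpace α] [MeasurableSpace β]
    {μ : Measure α} {f : α → β} {g : β → α} (hf : Measurable f) (hg : Measurable g)
    (hfg : Function.RightInverse g f) (hgf : ∀ᵐ x ∂μ, g (f x) = x) (s : Set β) :
    μ.map f s ≤ μ (f ⁻¹' s) := by
  -- Pulled back along `g`, the measurable hull of the preimage is a measurable set that contains
  -- `s`.
  have hA := measurableSet_toMeasurable μ (f ⁻¹' s)
  calc μ.map f s ≤ μ.map f (g ⁻¹' toMeasurable μ (f ⁻¹' s)) := by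
        refine measure_mono fun y hy => subset_toMeasurable μ _ ?_
        rw [mem_preimage, hfg y]
        exact hy
    _ = μ (f ⁻¹' (g ⁻¹' toMeasurable μ (f ⁻¹' s))) := Measure.map_apply hf (hg hA)
    _ = μ (toMeasurable μ (f ⁻¹' s)) := by
        refine measure_congr ?_
        filter_upwards [hgf] with x hx
        exact congrArg (toMeasurable μ (f ⁻¹' s)) hx
    _ = μ (f ⁻¹' s) := measure_toMeasurable _

/-- Comparison of the integrals of a bounded function of finitely many coordinates under a product
measure and under a product measure with densities. -/
theorem enorm_integral_infinitePi_withDensity_sub_le {ι : Type*} {X : ι → Type*}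
    [∀ i, MeasurableSpace (X i)] (μ : ∀ i, Measure (X i)) [∀ i, IsProbabilityMeasure (μ i)]
    {f : ∀ i, X i → ENNReal} (hf : ∀ i, Measurable (f i))
    [∀ i, IsProbabilityMeasure ((μ i).withDensity (f i))] (s : Finset ι)
    {g : (∀ i : s, X i) → ℝ} (hg : Measurable g) (hg1 : ∀ y, |g y| ≤ 1) :
    ‖∫ x, g (s.restrict x) ∂Measure.infinitePi (fun i => (μ i).withDensity (f i))
        - ∫ x, g (s.restrict x) ∂Measure.infinitePi μ‖ₑ
      ≤ ∫⁻ x, ‖∏ i ∈ s, (f i (x i)).toReal - 1‖ₑ ∂Measure.infinitePi μ := by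
  set P := Measure.infinitePi μ with hP
  set L : (∀ i, X i) → ENNReal := fun x => ∏ i ∈ s, f i (x i) with hL
  have hLm : Measurable L := Finset.measurable_prod _ fun i _ =>
    (hf i).comp (measurable_pi_apply i)
  have hL1 : ∫⁻ x, L x ∂P = 1 := by
    rw [hL, hP, Measure.lintegral_infinitePi_prod μ s hf]
    refine Finset.prod_eq_one fun i _ => ?_
    rw [← setLIntegral_univ, ← withDensity_apply _ .univ, measure_univ]
  have hLtop : ∫⁻ x, L x ∂P ≠ ⊤ := by rw [hL1]; exact ENNReal.one_ne_top
  have hr := s.measurable_restrict (X := X)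
  have hgr : Measurable fun x : ∀ i, X i => g (s.restrict x) := hg.comp hr
  -- Only the marginal on `s` matters, and it has the density `L` with respect to that of `P`.
  have h1 : ∫ x, g (s.restrict x) ∂Measure.infinitePi (fun i => (μ i).withDensity (f i))
      = ∫ x, (L x).toReal * g (s.restrict x) ∂P := by
    rw [← integral_map hr.aemeasurable hg.aestronglyMeasurable,
      Measure.map_restrict_infinitePi_withDensity μ hf s,
      integral_map hr.aemeasurable hg.aestronglyMeasurable,
      integral_withDensity_eq_integral_toReal_smul hLm (ae_lt_top hLm hLtop)]
    rfl
  have hLi : Integrable (fun x => (L x).toReal) P :=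
    integrable_toReal_of_lintegral_ne_top hLm.aemeasurable hLtop
  have hi1 : Integrable (fun x => (L x).toReal * g (s.restrict x)) P :=
    hLi.mul_bdd hgr.aestronglyMeasurable (ae_of_all _ fun x => hg1 _)
  have hi2 : Integrable (fun x => g (s.restrict x)) P :=
    Integrable.of_bound hgr.aestronglyMeasurable 1 (ae_of_all _ fun x => hg1 _)
  rw [h1, ← integral_sub hi1 hi2]
  refine (enorm_integral_le_lintegral_enorm _).trans (lintegral_mono fun x => ?_)
  rw [← sub_one_mul, enorm_mul]
  refine le_trans (mul_le_of_le_one_right' ?_) (le_of_eq ?_)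
  · rw [Real.enorm_eq_ofReal_abs, ENNReal.ofReal_le_one]
    exact hg1 _
  · rw [hL, ENNReal.toReal_prod]

end MeasureTheory

namespace WhiteNoise

theorem BL1.continuous {T : Type*} [PseudoMetricSpace T] {u : T → ℝ} (hu : u ∈ BL1 T) :
    Continuous u := by
  obtain ⟨b, K, -, h, -⟩ := hu
  exact h.continuous

theorem BL1.abs_le_one {T : Type*} [PseudoMetricSpace T] {u : T → ℝ} (hu : u ∈ BL1 T) (t : T) :
    |u t| ≤ 1 := by
  obtain ⟨b, K, h1, -, h3⟩ := hu
  linarith [h1 t, K.coe_nonneg]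

theorem BL1.abs_sub_le {T : Type*} [PseudoMetricSpace T] {u : T → ℝ} (hu : u ∈ BL1 T) (s t : T) :
    |u s - u t| ≤ dist s t := by
  obtain ⟨b, K, h1, h2, h3⟩ := hu
  have hb : 0 ≤ b := (abs_nonneg _).trans (h1 s)
  have := h2.dist_le_mul s t
  rw [Real.dist_eq] at this
  exact this.trans (mul_le_of_le_one_left dist_nonneg (by linarith))

theorem boundedLipschitzDist_le {T : Type*} [PseudoMetricSpace T] [MeasurableSpace T]
    {μ ν : Measure T} {ε : ℝ} (hε : 0 ≤ ε)
    (h : ∀ u ∈ BL1 T, ‖∫ t, u t ∂μ - ∫ t, u t ∂ν‖ₑ ≤ ENNReal.ofReal ε) :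
    boundedLipschitzDist μ ν ≤ ε := by
  -- The zero function witnesses that the supremum is over a nonempty set.
  refine csSup_le ⟨_, 0, ⟨0, 0, by simp, LipschitzWith.const 0, by simp⟩, rfl⟩ ?_
  rintro _ ⟨u, hu, rfl⟩
  have := h u hu
  rwa [Real.enorm_eq_ofReal_abs, ENNReal.ofReal_le_ofReal_iff hε] at this

namespace RegularBasis

variable {S : ℕ} (B : RegularBasis S)

/-- The weights outside of a finite set of indices. -/
noncomputable def tailWeight (δ : ℝ) (F : Finset B.Index) (i : B.Index) : ℝ :=
  open scoped Classical in if i ∈ F then 0 else B.weight (-1 / 2) δ i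

theorem tailWeight_nonneg (δ : ℝ) (F : Finset B.Index) (i : B.Index) : 0 ≤ B.tailWeight δ F i := by
  unfold tailWeight
  split_ifs
  exacts [le_rfl, (B.weight_pos _ _ i).le]

/-- The weighted second moment of the coordinates outside of a finite set. -/
noncomputable def tailMoment (δ : ℝ) (F : Finset B.Index) (q : B.Index → Measure ℝ) : ENNReal :=
  ∑' i, ENNReal.ofReal (B.tailWeight δ F i) * ∫⁻ y, ENNReal.ofReal (y ^ 2) ∂q i

/-- The array on a finite set of indices, extended by `0`. -/
noncomputable def extendZero (F : Finset B.Index) (y : F → ℝ) (i : B.Index) : ℝ :=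
  open scoped Classical in if h : i ∈ F then y ⟨i, h⟩ else 0

theorem measurable_extendZero (F : Finset B.Index) : Measurable (B.extendZero F) := by
  refine measurable_pi_lambda _ fun i => ?_
  by_cases h : i ∈ F
  · simpa only [extendZero, h, dif_pos] using measurable_pi_apply _
  · simp only [extendZero, dif_neg h]
    exact measurable_const

theorem norm_ofSeq_sub_extendZero_sq {δ : ℝ} (F : Finset B.Index) {h : B.Index → ℝ}
    (hh : Summable fun i => B.tailWeight δ F i * h i ^ 2) :
    ‖B.ofSeq (-1 / 2) δ h - B.ofSeq (-1 / 2) δ (B.extendZero F (F.restrict h))‖ ^ 2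
      = ∑' i, B.tailWeight δ F i * h i ^ 2 := by
  classical
  have he : Summable fun i => B.weight (-1 / 2) δ i * B.extendZero F (F.restrict h) i ^ 2 := by
    refine summable_of_ne_finset_zero (s := F) fun i hi => ?_
    simp [extendZero, hi]
  -- The coordinates in `F` are finitely many, so summability of the tail is enough for `h` to have
  -- an element of `H(δ)`.
  have hw : Summable fun i => B.weight (-1 / 2) δ i * h i ^ 2 := by
    refine (hh.add he).congr fun i => ?_
    by_cases hi : i ∈ F <;> simp [tailWeight, extendZero, hi]
  rw [B.norm_sq_eq]
  refine tsum_congr fun i => ?_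
  rw [LogSobolev.val_sub, B.ofSeq_val hw, B.ofSeq_val he]
  by_cases hi : i ∈ F <;> simp [tailWeight, extendZero, hi]

/-- The cost of truncating to `F`. If `d` is the norm of the discarded part, the function changes by
at most `d ≤ η + η⁻¹ d²`, and the mean of `d²` is the tail moment. -/
theorem enorm_integral_ofSeq_sub_le {δ : ℝ} (F : Finset B.Index) (q : B.Index → Measure ℝ)
    [∀ i, IsProbabilityMeasure (q i)] {u : B.H δ → ℝ} (hu : u ∈ BL1 (B.H δ)) {η : ℝ}
    (hη : 0 < η) :
    ‖∫ h, u (B.ofSeq (-1 / 2) δ h) ∂Measure.infinitePi q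
        - ∫ h, u (B.ofSeq (-1 / 2) δ (B.extendZero F (F.restrict h))) ∂Measure.infinitePi q‖ₑ
      ≤ ENNReal.ofReal η + ENNReal.ofReal η⁻¹ * B.tailMoment δ F q := by
  by_cases hT : B.tailMoment δ F q = ⊤
  · rw [hT, ENNReal.mul_top (by simpa using hη), add_top]
    exact le_top
  have hum : Measurable u := (BL1.continuous hu).measurable
  have hof := B.measurable_ofSeq (-1 / 2) δ
  have h1 : Measurable fun h => u (B.ofSeq (-1 / 2) δ h) := hum.comp hof
  have hrestr : Measurable fun h : B.Index → ℝ => B.extendZero F (F.restrict h) :=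
    Measurable.comp (g := B.extendZero F) (f := fun h : B.Index → ℝ => F.restrict h)
      (B.measurable_extendZero F) (Finset.measurable_restrict F)
  have h2 : Measurable fun h : B.Index → ℝ =>
      u (B.ofSeq (-1 / 2) δ (B.extendZero F (F.restrict h))) :=
    hum.comp (hof.comp hrestr)
  have hsum := ae_summable_infinitePi q (B.tailWeight_nonneg δ F) hT
  rw [← integral_sub (Integrable.of_bound h1.aestronglyMeasurable 1
    (ae_of_all _ fun h => BL1.abs_le_one hu _)) (Integrable.of_bound h2.aestronglyMeasurable 1
    (ae_of_all _ fun h => BL1.abs_le_one hu _))]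
  refine (enorm_integral_le_lintegral_enorm _).trans ?_
  have hbound : ∀ᵐ h ∂Measure.infinitePi q, ‖u (B.ofSeq (-1 / 2) δ h)
      - u (B.ofSeq (-1 / 2) δ (B.extendZero F (F.restrict h)))‖ₑ
      ≤ ENNReal.ofReal η + ENNReal.ofReal η⁻¹ *
        ∑' i, ENNReal.ofReal (B.tailWeight δ F i) * ENNReal.ofReal (h i ^ 2) := by
    filter_upwards [hsum] with h hh
    set d := ‖B.ofSeq (-1 / 2) δ h - B.ofSeq (-1 / 2) δ (B.extendZero F (F.restrict h))‖ with hd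
    have hd2 := B.norm_ofSeq_sub_extendZero_sq F hh
    have hE : ∑' i, ENNReal.ofReal (B.tailWeight δ F i) * ENNReal.ofReal (h i ^ 2)
        = ENNReal.ofReal (d ^ 2) := by
      rw [hd2, ENNReal.ofReal_tsum_of_nonneg
        (fun i => mul_nonneg (B.tailWeight_nonneg δ F i) (sq_nonneg _)) hh]
      exact tsum_congr fun i => (ENNReal.ofReal_mul (B.tailWeight_nonneg δ F i)).symm
    rw [hE, ← ENNReal.ofReal_mul (by positivity), ← ENNReal.ofReal_add hη.le (by positivity),
      Real.enorm_eq_ofReal_abs]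
    refine ENNReal.ofReal_le_ofReal ((BL1.abs_sub_le hu _ _).trans ?_)
    rw [dist_eq_norm, ← hd, ← sub_nonneg]
    have : η + η⁻¹ * d ^ 2 - d = η⁻¹ * ((d - η / 2) ^ 2 + 3 / 4 * η ^ 2) := by
      field_simp
      ring
    rw [this]
    positivity
  refine (lintegral_mono_ae hbound).trans (le_of_eq ?_)
  rw [lintegral_add_left measurable_const, lintegral_const, measure_univ, mul_one,
    lintegral_const_mul _ (by fun_prop), lintegral_tsum fun i => Measurable.aemeasurable (by fun_prop)]
  congr 2
  refine tsum_congr fun i => ?_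
  rw [lintegral_const_mul _ (by fun_prop)]
  congr 1
  exact (measurePreserving_eval_infinitePi q i).lintegral_comp
    (f := fun y => ENNReal.ofReal (y ^ 2)) (by fun_prop)

/-- A bound for the bounded Lipschitz distance to the Gaussian measure of a product measure whose
factors have densities with respect to `N(0,1)`. -/
theorem enorm_integral_map_ofSeq_sub_gaussian_le {δ : ℝ} (F : Finset B.Index)
    {r : B.Index → ℝ → ENNReal} (hr : ∀ i, Measurable (r i))
    [∀ i, IsProbabilityMeasure ((gaussianReal 0 1).withDensity (r i))]
    {u : B.H δ → ℝ} (hu : u ∈ BL1 (B.H δ)) {η : ℝ} (hη : 0 < η) :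
    ‖∫ x, u x ∂(Measure.infinitePi fun i => (gaussianReal 0 1).withDensity (r i)).map
          (B.ofSeq (-1 / 2) δ) - ∫ x, u x ∂B.gaussian δ‖ₑ
      ≤ (ENNReal.ofReal η + ENNReal.ofReal η⁻¹ *
          B.tailMoment δ F fun i => (gaussianReal 0 1).withDensity (r i))
        + ∫⁻ h, ‖∏ i ∈ F, (r i (h i)).toReal - 1‖ₑ ∂gaussianSeq B.Index
        + (ENNReal.ofReal η + ENNReal.ofReal η⁻¹ *
          B.tailMoment δ F fun _ => gaussianReal 0 1) := by
  have hum : Measurable u := (BL1.continuous hu).measurable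
  have hof := B.measurable_ofSeq (-1 / 2) δ
  have hgm : Measurable fun y => u (B.ofSeq (-1 / 2) δ (B.extendZero F y)) :=
    hum.comp (hof.comp (B.measurable_extendZero F))
  rw [integral_map hof.aemeasurable hum.aestronglyMeasurable, gaussian,
    integral_map hof.aemeasurable hum.aestronglyMeasurable]
  set a := ∫ h, u (B.ofSeq (-1 / 2) δ h)
    ∂Measure.infinitePi fun i => (gaussianReal 0 1).withDensity (r i)
  set a' := ∫ h, u (B.ofSeq (-1 / 2) δ (B.extendZero F (F.restrict h)))
    ∂Measure.infinitePi fun i => (gaussianReal 0 1).withDensity (r i)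
  set b := ∫ h, u (B.ofSeq (-1 / 2) δ h) ∂gaussianSeq B.Index
  set b' := ∫ h, u (B.ofSeq (-1 / 2) δ (B.extendZero F (F.restrict h))) ∂gaussianSeq B.Index
  have h1 : ‖a - a'‖ₑ ≤ _ := B.enorm_integral_ofSeq_sub_le F _ hu hη
  have h2 : ‖a' - b'‖ₑ ≤ _ := enorm_integral_infinitePi_withDensity_sub_le
    (fun _ : B.Index => gaussianReal 0 1) hr F hgm fun y => BL1.abs_le_one hu _
  have h3 : ‖b - b'‖ₑ ≤ _ := B.enorm_integral_ofSeq_sub_le F _ hu hη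
  -- Truncate under the product measure, compare the finite-dimensional laws, and undo the
  -- truncation under the Gaussian.
  calc ‖a - b‖ₑ = ‖(a - a') + (a' - b') + (b' - b)‖ₑ := by congr 1; ring
    _ ≤ ‖a - a'‖ₑ + ‖a' - b'‖ₑ + ‖b' - b‖ₑ :=
        (enorm_add_le _ _).trans (add_le_add_left (enorm_add_le _ _) _)
    _ ≤ _ := by
        rw [← enorm_neg (b' - b), neg_sub]
        exact add_le_add (add_le_add h1 h2) h3

theorem tendsto_tsum_tailWeight {δ : ℝ} (hδ : 1 / 2 < δ) :
    Tendsto (fun F => ∑' i, ENNReal.ofReal (B.tailWeight δ F i)) atTop (𝓝 0) := by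
  classical
  refine (ENNReal.tendsto_tsum_compl_atTop_zero
    (f := fun i => ENNReal.ofReal (B.weight (-1 / 2) δ i))
    (B.summable_weight hδ).tsum_ofReal_ne_top).congr fun F => ?_
  refine (tsum_subtype {i | i ∉ F} fun i => ENNReal.ofReal (B.weight (-1 / 2) δ i)).trans ?_
  refine tsum_congr fun i => ?_
  by_cases hi : i ∈ F <;> simp [tailWeight, hi]

end RegularBasis

end WhiteNoise

/-! ### Convergence in probability under the true parameter -/

namespace WhiteNoise

namespace RegularBasis

variable {S : ℕ} (B : RegularBasis S)

theorem tailMoment_gaussian (δ : ℝ) (F : Finset B.Index) :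
    B.tailMoment δ F (fun _ => gaussianReal 0 1) = ∑' i, ENNReal.ofReal (B.tailWeight δ F i) := by
  simp_rw [tailMoment, lintegral_sq_gaussianReal, mul_one]

/-- The white noise experiment in terms of the coefficients of the noise. -/
theorem experiment_apply_le {δ : ℝ} (hδ : 1 / 2 < δ) {n : ℕ} (hn : n ≠ 0) (f : L2)
    (A : Set (B.H δ)) :
    B.experiment δ n f A ≤ gaussianSeq B.Index
      {w | B.incl δ f + (√(n : ℝ))⁻¹ • B.ofSeq (-1 / 2) δ w ∈ A} := by
  have hsn : √(n : ℝ) ≠ 0 := by positivity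
  have hof := B.measurable_ofSeq (-1 / 2) δ
  have hadd : Measurable fun w : B.H δ => B.incl δ f + (√(n : ℝ))⁻¹ • w := by fun_prop
  have hlaw : B.experiment δ n f = (gaussianSeq B.Index).map
      fun w => B.incl δ f + (√(n : ℝ))⁻¹ • B.ofSeq (-1 / 2) δ w := by
    change (B.gaussian δ).map (fun w => B.incl δ f + (√(n : ℝ))⁻¹ • w) = _
    rw [gaussian, Measure.map_map hadd hof]
    rfl
  rw [hlaw]
  -- Measurability of `A` is not assumed, as it will be an event on a supremum over an uncountable
  -- class. The noise is recovered from the data as `√n (x - f)`.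
  refine Measure.map_apply_le_of_rightInverse (g := fun x => (√(n : ℝ) • (x - B.incl δ f)).val)
    (hadd.comp hof) ((B.measurable_val _ _).comp (by fun_prop)) (fun x => ?_) ?_ A
  · simp only [Function.comp_apply, B.ofSeq_val_self, inv_smul_smul₀ hsn, add_sub_cancel]
  · filter_upwards [B.ae_summable_gaussian hδ] with w hw
    rw [Function.comp_apply, add_sub_cancel_left, smul_inv_smul₀ hsn, B.ofSeq_val hw]

end RegularBasis

namespace ScaledDensities

variable {S : ℕ} {B : RegularBasis S} (Q : ScaledDensities B)

/-- The weighted second moment of the posterior outside of a finite set of coordinates. -/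
noncomputable def posteriorTail (δ t : ℝ) (F : Finset B.Index) (x : B.Index → ℝ) : ENNReal :=
  B.tailMoment δ F fun i => localPosterior (Q.density i) t (x i)

/-- The `L¹`-distance to `1` of the density of the posterior of finitely many coordinates. -/
noncomputable def posteriorDiscrepancy (t : ℝ) (F : Finset B.Index) (x : B.Index → ℝ) : ENNReal :=
  ∫⁻ h, ‖∏ i ∈ F, (localDensity (Q.density i) t (x i) (h i)).toReal - 1‖ₑ ∂gaussianSeq B.Index

theorem measurable_lintegral_sq_localPosterior (i : B.Index) (t : ℝ) :
    Measurable fun x => ∫⁻ y, ENNReal.ofReal (y ^ 2) ∂localPosterior (Q.density i) t x :=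
  Measurable.lintegral_kernel (by fun_prop)

theorem measurable_posteriorTail (δ t : ℝ) (F : Finset B.Index) :
    Measurable (Q.posteriorTail δ t F) := by
  refine Measurable.tsum fun i => Measurable.const_mul ?_ _
  exact (Q.measurable_lintegral_sq_localPosterior i t).comp (measurable_pi_apply i)

theorem measurable_localDensity_apply (i : B.Index) (t : ℝ) :
    Measurable fun p : (B.Index → ℝ) × (B.Index → ℝ) =>
      localDensity (Q.density i) t (p.1 i) (p.2 i) :=
  (measurable_localDensity (Q.measurable_density i) t).comp
    (by fun_prop : Measurable fun p : (B.Index → ℝ) × (B.Index → ℝ) => (p.1 i, p.2 i))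

theorem measurable_posteriorDiscrepancy (t : ℝ) (F : Finset B.Index) :
    Measurable (Q.posteriorDiscrepancy t F) := by
  have h : Measurable fun p : (B.Index → ℝ) × (B.Index → ℝ) =>
      ‖∏ i ∈ F, (localDensity (Q.density i) t (p.1 i) (p.2 i)).toReal - 1‖ₑ :=
    ((Finset.measurable_prod _ fun i _ =>
      (Q.measurable_localDensity_apply i t).ennreal_toReal).sub_const 1).enorm
  exact h.lintegral_prod_right'

theorem enorm_integral_posteriorSeq_sub_gaussian_le {δ : ℝ} (t : ℝ) (F : Finset B.Index)
    (x : B.Index → ℝ) {u : B.H δ → ℝ} (hu : u ∈ BL1 (B.H δ)) {η : ℝ} (hη : 0 < η) :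
    ‖∫ y, u y ∂(Q.posteriorSeq t x).map (B.ofSeq (-1 / 2) δ) - ∫ y, u y ∂B.gaussian δ‖ₑ
      ≤ (ENNReal.ofReal η + ENNReal.ofReal η⁻¹ * Q.posteriorTail δ t F x)
        + Q.posteriorDiscrepancy t F x
        + (ENNReal.ofReal η + ENNReal.ofReal η⁻¹ *
          ∑' i, ENNReal.ofReal (B.tailWeight δ F i)) := by
  have hq : ∀ i, localPosterior (Q.density i) t (x i)
      = (gaussianReal 0 1).withDensity (localDensity (Q.density i) t (x i)) := fun i =>
    localPosterior_apply (Q.measurable_density i) t (x i)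
  have : ∀ i, IsProbabilityMeasure
      ((gaussianReal 0 1).withDensity (localDensity (Q.density i) t (x i))) := fun i => by
    rw [← hq i]; infer_instance
  have h := B.enorm_integral_map_ofSeq_sub_gaussian_le F
    (r := fun i => localDensity (Q.density i) t (x i))
    (fun i => (measurable_localDensity (Q.measurable_density i) t).of_uncurry_left) hu hη
  simp_rw [← hq] at h
  rwa [B.tailMoment_gaussian] at h

/-- The finite-dimensional posteriors converge in total variation. -/
theorem tendsto_posteriorDiscrepancy {θ : B.Index → ℝ} {C : ℝ} (hφ_le : ∀ x, Q.φ x ≤ C)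
    (hφ_pos : ∀ i : B.Index, 0 < Q.φ (θ i / Q.σ i.1))
    (hφ_cont : ∀ i : B.Index, ContinuousAt Q.φ (θ i / Q.σ i.1))
    {t : ℕ → ℝ} (ht : Tendsto t atTop (𝓝 0)) (F : Finset B.Index) (w : B.Index → ℝ) :
    Tendsto (fun n => Q.posteriorDiscrepancy (t n) F (θ + t n • w)) atTop (𝓝 0) := by
  have hσ : ∀ i : B.Index, 0 < Q.σ i.1 := fun i => Q.σ_pos _ i.1.2
  have hloc := fun i : B.Index => tendsto_localDensity (Q.measurable_density i)
    ENNReal.ofReal_ne_top (scaledDensity_le (hσ i) hφ_le)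
    (continuousAt_scaledDensity (hφ_cont i))
    (by
      have := hφ_pos i
      have := hσ i
      simp only [density, scaledDensity, ne_eq, ENNReal.ofReal_eq_zero, not_le]
      positivity) ht (w i)
  choose hlim b hb hbound using hloc
  -- Since `F` is finite, the bounds hold simultaneously from some `n` on, and the product of
  -- densities is dominated by a constant.
  have hall : ∀ᶠ n in atTop, ∀ i ∈ F, ∀ h,
      localDensity (Q.density i) (t n) (θ i + t n * w i) h ≤ b i :=
    (Finset.eventually_all F).2 fun i _ => hbound i
  have hdom := tendsto_lintegral_filter_of_dominated_convergence (μ := gaussianSeq B.Index)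
    (l := atTop) (f := fun _ => 0)
    (F := fun n h =>
      ‖∏ i ∈ F, (localDensity (Q.density i) (t n) ((θ + t n • w) i) (h i)).toReal - 1‖ₑ)
    (fun _ => ENNReal.ofReal (∏ i ∈ F, (b i).toReal + 1)) (Eventually.of_forall fun n => ?_) ?_ ?_ ?_
  · simpa [posteriorDiscrepancy] using hdom
  · exact ((Finset.measurable_prod _ fun i _ =>
      ((Q.measurable_localDensity_apply i (t n)).comp
        measurable_prodMk_left).ennreal_toReal).sub_const 1).enorm
  · filter_upwards [hall] with n hn
    refine ae_of_all _ fun h => ?_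
    rw [Real.enorm_eq_ofReal_abs]
    refine ENNReal.ofReal_le_ofReal ?_
    have h0 : 0 ≤ ∏ i ∈ F, (localDensity (Q.density i) (t n) ((θ + t n • w) i) (h i)).toReal :=
      Finset.prod_nonneg fun i _ => ENNReal.toReal_nonneg
    have h1 : ∏ i ∈ F, (localDensity (Q.density i) (t n) ((θ + t n • w) i) (h i)).toReal
        ≤ ∏ i ∈ F, (b i).toReal :=
      Finset.prod_le_prod (fun i _ => ENNReal.toReal_nonneg) fun i hi =>
        ENNReal.toReal_mono (hb i) (hn i hi (h i))
    rw [abs_le]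
    constructor <;> linarith
  · rw [lintegral_const, measure_univ, mul_one]
    exact ENNReal.ofReal_ne_top
  · refine ae_of_all _ fun h => ?_
    have h1 : Tendsto (fun n => ∏ i ∈ F,
        (localDensity (Q.density i) (t n) ((θ + t n • w) i) (h i)).toReal - 1) atTop (𝓝 0) := by
      have h2 := tendsto_finsetProd F fun i _ =>
        (ENNReal.tendsto_toReal ENNReal.one_ne_top).comp (hlim i (h i))
      simpa using h2.sub_const 1
    simpa using h1.enorm

/-- The tails of the posterior are small in expectation under the true parameter. -/
theorem lintegral_posteriorTail_le {θ : B.Index → ℝ} {t : ℝ} {D : ENNReal}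
    (hD : ∀ i : B.Index, ∫⁻ w, ∫⁻ h, ENNReal.ofReal (h ^ 2)
      ∂localPosterior (Q.density i) t (θ i + t * w) ∂gaussianReal 0 1 ≤ D)
    (δ : ℝ) (F : Finset B.Index) :
    ∫⁻ w, Q.posteriorTail δ t F (θ + t • w) ∂gaussianSeq B.Index
      ≤ (∑' i, ENNReal.ofReal (B.tailWeight δ F i)) * D := by
  have hm : ∀ i : B.Index, Measurable fun w : ℝ => ∫⁻ y, ENNReal.ofReal (y ^ 2)
      ∂localPosterior (Q.density i) t (θ i + t * w) := fun i =>
    (Q.measurable_lintegral_sq_localPosterior i t).comp (by fun_prop)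
  have hm' : ∀ i : B.Index, Measurable fun w : B.Index → ℝ => ∫⁻ y, ENNReal.ofReal (y ^ 2)
      ∂localPosterior (Q.density i) t ((θ + t • w) i) := fun i =>
    (hm i).comp (measurable_pi_apply i)
  simp only [posteriorTail, RegularBasis.tailMoment]
  rw [lintegral_tsum fun i => ((hm' i).const_mul _).aemeasurable, ← ENNReal.tsum_mul_right]
  refine ENNReal.tsum_le_tsum fun i => ?_
  rw [lintegral_const_mul _ (hm' i)]
  refine mul_le_mul_right (le_trans (le_of_eq ?_) (hD i)) _
  -- The posterior of coordinate `i` depends on the noise through `w i` alone.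
  exact (measurePreserving_eval_infinitePi (fun _ : B.Index => gaussianReal 0 1) i).lintegral_comp
    (hm i)

end ScaledDensities

end WhiteNoise

theorem theorem4p5 {S : ℕ} (B : RegularBasis S) (Q : ScaledDensities B) (f₀ : L2)
    (M τ c C : ℝ) (hM : 0 < M)
    (hP1 : ∀ i : B.Index, |B.coeff f₀ i| / Q.σ i.1 ≤ M)
    (hτ : M < τ) (hc : 0 < c) (hcC : c ≤ C)
    (hφ_le : ∀ x, Q.φ x ≤ C) (hφ_ge : ∀ x ∈ Ioo (-τ) τ, c ≤ Q.φ x)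
    (hφ_moment : Integrable fun x => x ^ 2 * Q.φ x)
    (hφ_cont : ∀ i : B.Index, ∀ᶠ x in 𝓝 (B.coeff f₀ i / Q.σ i.1), ContinuousAt Q.φ x)
    (δ : ℝ) (hδ : 1 / 2 < δ) :
    WeakBernsteinVonMises B δ Q.prior f₀ := by
  intro ε hε
  have hσ : ∀ i : B.Index, 0 < Q.σ i.1 := fun i => Q.σ_pos _ i.1.2
  obtain ⟨D, hD_top, hD⟩ := exists_lintegral_sq_localPosterior_le Q.measurable_φ Q.φ_nonneg
    Q.lintegral_φ hτ hc hφ_le hφ_ge hcC hφ_moment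
  have hpos : ∀ i : B.Index, 0 < Q.φ (B.coeff f₀ i / Q.σ i.1) := fun i => by
    refine hc.trans_le (hφ_ge _ (abs_lt.1 ?_))
    rw [abs_div, abs_of_pos (hσ i)]
    exact (hP1 i).trans_lt hτ
  set t : ℕ → ℝ := fun n => (√(n : ℝ))⁻¹ with ht
  have ht0 : Tendsto t atTop (𝓝 0) :=
    tendsto_inv_atTop_zero.comp (Real.tendsto_sqrt_atTop.comp tendsto_natCast_atTop_atTop)
  -- With `κ = η²` one has `η⁻¹ κ = η`, and the final bound is `5 η < ε`.
  set η := ε / 8 with hη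
  have hη0 : 0 < η := by positivity
  set κ := ENNReal.ofReal (η * η) with hκ
  have hκ0 : κ ≠ 0 := by simpa [hκ] using hη0.ne'
  rw [ENNReal.tendsto_nhds_zero]
  intro ζ hζ
  have hW := B.tendsto_tsum_tailWeight hδ
  have hζ2 : 0 < ζ / 2 := ENNReal.half_pos hζ.ne'
  have hWD : Tendsto (fun F => (∑' i, ENNReal.ofReal (B.tailWeight δ F i)) * D / κ) atTop
      (𝓝 0) := by
    have := ENNReal.Tendsto.div_const
      (ENNReal.Tendsto.mul_const hW (Or.inr hD_top.ne)) (b := κ) (Or.inr hκ0)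
    simpa using this
  -- The set `F` is fixed before `n`: it makes the Gaussian tail less than `κ` and the Markov bound
  -- for the posterior tail less than `ζ / 2`. This is possible since `D` does not depend on `n`.
  obtain ⟨F, hF1, hF2⟩ := ((hW.eventually (gt_mem_nhds (pos_iff_ne_zero.2 hκ0))).and
    (hWD.eventually (gt_mem_nhds hζ2))).exists
  have hηκ : ENNReal.ofReal η⁻¹ * κ = ENNReal.ofReal η := by
    rw [hκ, ← ENNReal.ofReal_mul (by positivity), inv_mul_cancel_left₀ hη0.ne']
  have hxm : ∀ n, Measurable fun w : B.Index → ℝ => B.coeff f₀ + t n • w := fun n => by fun_prop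
  -- For fixed `F` the discrepancy tends to zero for every `w`, hence in probability.
  have hΔ : Tendsto (fun n => gaussianSeq B.Index
      {w | ENNReal.ofReal η < Q.posteriorDiscrepancy (t n) F (B.coeff f₀ + t n • w)}) atTop
      (𝓝 0) := by
    have := tendsto_measure_of_ae_tendsto_indicator_of_isFiniteMeasure atTop
      (μ := gaussianSeq B.Index) (A := ∅) (As := fun n =>
        {w | ENNReal.ofReal η < Q.posteriorDiscrepancy (t n) F (B.coeff f₀ + t n • w)})
      MeasurableSet.empty (fun n => measurableSet_lt measurable_const
        ((Q.measurable_posteriorDiscrepancy _ F).comp (hxm n))) (ae_of_all _ fun w => ?_)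
    · simpa using this
    · have hlim := Q.tendsto_posteriorDiscrepancy hφ_le hpos
        (fun i => (hφ_cont i).self_of_nhds) ht0 F w
      filter_upwards [hlim.eventually (gt_mem_nhds (ENNReal.ofReal_pos.2 hη0))] with n hn
      simpa using hn.le
  filter_upwards [hΔ.eventually (gt_mem_nhds hζ2), eventually_ne_atTop 0] with n hn hn0
  have htn : 0 < t n := by
    simp only [ht]; positivity
  refine (B.experiment_apply_le hδ hn0 f₀ _).trans ?_
  have hsub : {w | B.incl δ f₀ + (√(n : ℝ))⁻¹ • B.ofSeq (-1 / 2) δ w ∈ {x | ε <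
        boundedLipschitzDist (B.rescaledPosterior δ Q.prior n x) (B.gaussian δ)}}
      ≤ᵐ[gaussianSeq B.Index] ({w | κ ≤ Q.posteriorTail δ (t n) F (B.coeff f₀ + t n • w)} ∪
        {w | ENNReal.ofReal η < Q.posteriorDiscrepancy (t n) F (B.coeff f₀ + t n • w)} :
        Set (B.Index → ℝ)) := by
    -- Outside the two exceptional events the bound for test functions holds with the same
    -- right-hand side for all of them, so it bounds the supremum.
    filter_upwards [Q.rescaledPosterior_ae_eq hφ_moment hδ hn0 f₀] with w hw hbad
    change ε < boundedLipschitzDist (B.rescaledPosterior δ Q.prior n _) _ at hbad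
    by_contra hgood
    have hgood' : ¬ (κ ≤ Q.posteriorTail δ (t n) F (B.coeff f₀ + t n • w) ∨
      ENNReal.ofReal η < Q.posteriorDiscrepancy (t n) F (B.coeff f₀ + t n • w)) := hgood
    push Not at hgood'
    refine hbad.not_ge (boundedLipschitzDist_le hε.le fun u hu => ?_)
    rw [hw]
    refine (Q.enorm_integral_posteriorSeq_sub_gaussian_le (t n) F _ hu hη0).trans ?_
    calc _ ≤ (ENNReal.ofReal η + ENNReal.ofReal η⁻¹ * κ) + ENNReal.ofReal η
          + (ENNReal.ofReal η + ENNReal.ofReal η⁻¹ * κ) := by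
          gcongr
          exacts [hgood'.1.le, hgood'.2]
      _ ≤ ENNReal.ofReal ε := by
          rw [hηκ, ← ENNReal.ofReal_add hη0.le hη0.le, ← ENNReal.ofReal_add (by positivity) hη0.le,
            ← ENNReal.ofReal_add (by positivity) (by positivity)]
          refine ENNReal.ofReal_le_ofReal ?_
          rw [hη]
          linarith
  refine (measure_mono_ae hsub).trans ((measure_union_le _ _).trans ?_)
  rw [← ENNReal.add_halves ζ]
  refine add_le_add ?_ hn.le
  -- Markov's inequality for the posterior tail, whose expectation is at most the tail of the
  -- weights times `D`.
  refine (meas_ge_le_lintegral_div ((Q.measurable_posteriorTail δ (t n) F).comp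
    (hxm n)).aemeasurable hκ0 (by simp [hκ])).trans ?_
  refine (ENNReal.div_le_div_right ?_ _).trans hF2.le
  exact Q.lintegral_posteriorTail_le (fun i => hD _ _ _ (hσ i) htn (hP1 i)) δ F
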